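/- Let $p\in(0,1)$ and let $S$ be a countable set. Let $\beta_p=(1-p)\delta_0+p\delta_1$ be the Bernoulli measure on $\{0,1\}$, $\gamma$ the standard Gaussian measure on $\mathbb R$, and $\mu=\lambda_p^S\otimes\gamma^{\mathbb N}$ the product measure on $\{0,1\}^S\times\mathbb R^{\mathbb N}$, where $\lambda_p^S=\beta_p^{\otimes S}$ and $\gamma^{\mathbb N}=\gamma^{\otimes\mathbb N}$. Points are written $(x,y)$, and $\mathsf{Var}$, $\mathbb E$, $\|\cdot\|_1$ refer to $\mu$. For $f\in L^2(\mu)$, $s\in S$ and $i\in\mathbb N$ put $$\Delta_s f=f-\int f\,d\beta_p(x_s),\qquad \Delta_i f=f-\int f\,d\gamma(y_i),$$ the integration being over the single coordinate $x_s$, respectively $y_i$. Let $$c_{LS}(p)=\frac{\log p-\log(1-p)}{p-(1-p)}\quad (p\neq 1/2),\qquad c_{LS}(1/2)=2 .$$ The weighted Sobolev space $H_1^2(\mu)$ is the set of $f\in L^2(\mu)$ such that for every $i\in\mathbb N$ there is $h_i\in L^2(\mu)$ such that, for $\mu$-almost every $(x,y)$, with all coordinates other than $y_i$ fixed, the functions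 $y_i\mapsto f(x,y)$ and $y_i\mapsto h_i(x,y)$ are locally integrable and $$-\int_{\mathbb R} g'(y_i)f(x,y)\,dy_i=\int_{\mathbb R} g(y_i)h_i(x,y)\,dy_i$$ for every smooth compactly supported $g:\mathbb R\to\mathbb R$. The function $h_i$ is denoted $\frac{\partial f}{\partial y_i}$. Then for every $f\in H_1^2(\mu)$, $$\mathsf{Var}(f)\,\log\frac{\mathsf{Var}(f)}{\sum_{s\in S}\|\Delta_s f\|_1^2+\sum_{i\in\mathbb N}\|\Delta_i f\|_1^2}\;\le\; c_{LS}(p)\sum_{s\in S}\mathbb E\big((\Delta_s f)^2\big)+2\sum_{i\in\mathbb N}\mathbb E\Big(\Big(\frac{\partial f}{\partial y_i}\Big)^2\Big).$$ The inequality is understood in $[-\infty,\infty]$: the sums may be infinite, $\log 0=-\infty$, and the left-hand side is $0$ if $\mathsf{Var}(f)=0$. -/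

import Mathlib

open MeasureTheory ProbabilityTheory
open scoped ENNReal ContDiff unitInterval

noncomputable section

namespace BernoulliGauss

/-- The Bernoulli measure `(1 - p) δ₀ + p δ₁` on `{0, 1}`, with `false` for `0` and `true` for `1`. -/
def ber (p : I) : Measure Bool := bernoulliMeasure true false p

/-- The standard Gaussian measure on `ℝ`. -/
def gauss : Measure ℝ := gaussianReal 0 1

/-- The sample space `{0, 1}^S × ℝ^ℕ`. -/
abbrev Space (S : Type*) : Type _ := (S → Bool) × (ℕ → ℝ)

/-- The product measure `λ_p^S ⊗ γ^ℕ` on `{0, 1}^S × ℝ^ℕ`. -/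
def mu (S : Type*) (p : I) : Measure (Space S) :=
  (Measure.infinitePi (fun _ : S => ber p)).prod (Measure.infinitePi (fun _ : ℕ => gauss))

/-- The constant in the logarithmic Sobolev inequality of the Bernoulli measure; its value at
`p = 1/2` is the limit `2`. -/
def cLS (p : ℝ) : ℝ :=
  if p = 1 / 2 then 2 else (Real.log p - Real.log (1 - p)) / (p - (1 - p))

open Classical in
/-- `Δ_s f = f - ∫ f dβ_p`, the integral being over the Bernoulli coordinate `s`. -/
def deltaBer {S : Type*} (p : I) (s : S) (f : Space S → ℝ) (z : Space S) : ℝ :=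
  f z - ∫ b, f (Function.update z.1 s b, z.2) ∂(ber p)

/-- `Δ_i f = f - ∫ f dγ`, the integral being over the Gaussian coordinate `i`. -/
def deltaGauss {S : Type*} (i : ℕ) (f : Space S → ℝ) (z : Space S) : ℝ :=
  f z - ∫ t, f (z.1, Function.update z.2 i t) ∂gauss

/-- `f'` is a weak derivative of `f` on the real line. -/
def HasWeakDeriv (f f' : ℝ → ℝ) : Prop :=
  LocallyIntegrable f ∧ LocallyIntegrable f' ∧
    ∀ g : ℝ → ℝ, ContDiff ℝ ∞ g → HasCompactSupport g →
      ∫ t, g t * f' t = - ∫ t, deriv g t * f t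

/-- `h` is a square integrable partial derivative of `f` with respect to the Gaussian coordinate
`i`: on almost every line parallel to the `i`-th axis, `h` is a weak derivative of `f`. -/
def IsPartialDeriv {S : Type*} (p : I) (i : ℕ) (f h : Space S → ℝ) : Prop :=
  MemLp h 2 (mu S p) ∧
    ∀ᵐ z ∂(mu S p), HasWeakDeriv (fun t => f (z.1, Function.update z.2 i t))
      (fun t => h (z.1, Function.update z.2 i t))

/-- Membership in the weighted Sobolev space `H_1^2(λ_p^S ⊗ γ^ℕ)`. -/
def MemH12 {S : Type*} (p : I) (f : Space S → ℝ) : Prop :=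
  MemLp f 2 (mu S p) ∧ ∀ i : ℕ, ∃ h : Space S → ℝ, IsPartialDeriv p i f h

/-- `E(f ^ 2)`, with values in `[0, ∞]`. -/
def energy {S : Type*} (p : I) (f : Space S → ℝ) : ℝ≥0∞ :=
  ∫⁻ z, ENNReal.ofReal (f z ^ 2) ∂(mu S p)

end BernoulliGauss

end

/-! This is the Falik–Samorodnitsky argument. Enumerate all coordinates by `ℕ` and let `K n` be the
kernel that resamples the `n`-th one, so that `avg (K n)` is the conditional expectation given the
others. Averaging out one coordinate after another splits `f` minus its mean into orthogonal
increments `d_n = avgIter K n f - avgIter K (n + 1) f`, whose squared norms add up to the variance.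

Each `d_n` satisfies a logarithmic Sobolev inequality, since the one-coordinate inequalities
tensorize (`IsLogSobolev.entBound_tsum`). On the other side, entropy controls the gap between the
`L²` and `L¹` norms: `‖g‖₂² (1 + log t) ≤ Ent(g²) + t ‖g‖₁²` for every `t > 0`
(`EntBound.integral_sq_mul_le`). With one `t` common to all `n` this is additive in the increments.
The sum over `n` gives `Var f` on the left. On the right, the energies of `d_n` in a fixed direction
telescope to at most the energy of `f`, and `‖d_n‖₁ ≤ ‖Δ_n f‖₁` because averaging contracts `L¹` and
the kernels commute (`IsLogSobolev.variance_mul_le`). The choice `t = Var f / ∑ ‖Δ_n f‖₁²` gives the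
theorem (`ofReal_mul_log_le`).

The entropy is used only in its dual form `EntBound`, tested against bounded functions, so `g² log
g²` never has to be integrated. There remain the one-coordinate inequalities. The Bernoulli one
(`two_point`) is a determinant condition that follows from superadditivity of the logarithmic mean.
The Gaussian one (`entBound_gauss`) follows from monotone transport and integration by parts on
bounded intervals, then a cut-off limit. -/

noncomputable section

namespace BernoulliGauss

open Filter Topology

/-! ### Averaging over resampling kernels as conditional expectation. -/

variable {X : Type*} [MeasurableSpace X] {μ : Measure X} {κ η : Kernel X X}

/-- The average of `f` with respect to the kernel `κ`. -/
def avg (κ : Kernel X X) (f : X → ℝ) (z : X) : ℝ := ∫ w, f w ∂(κ z)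

/-- A kernel that preserves `μ` and resamples its starting point within an equivalence class. -/
structure IsResampling (κ : Kernel X X) (μ : Measure X) : Prop where
  comp_eq : κ ∘ₘ μ = μ
  ae_avg_eq : ∀ f, StronglyMeasurable f → ∀ z, ∀ᵐ w ∂(κ z), avg κ f w = avg κ f z

theorem eLpNorm_two_eq_ofReal_sqrt {f : X → ℝ} (hf : MemLp f 2 μ) :
    eLpNorm f 2 μ = ENNReal.ofReal (√(∫ z, f z ^ 2 ∂μ)) := by
  rw [hf.eLpNorm_eq_integral_rpow_norm (by norm_num) (by norm_num)]
  simp [Real.sqrt_eq_rpow]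

theorem sq_integral_le_integral_sq [IsProbabilityMeasure μ] {f : X → ℝ} (hf : MemLp f 2 μ) :
    (∫ z, f z ∂μ) ^ 2 ≤ ∫ z, f z ^ 2 ∂μ := by
  have h := variance_eq_sub hf
  have h2 := variance_nonneg f μ
  simp only [Pi.pow_apply] at h
  linarith

theorem stronglyMeasurable_avg [IsMarkovKernel κ] {f : X → ℝ} (hf : StronglyMeasurable f) :
    StronglyMeasurable (avg κ f) :=
  hf.integral_kernel

namespace IsResampling

section

variable (h : IsResampling κ μ)
include h

theorem ae_ae {P : X → Prop} (hP : ∀ᵐ z ∂μ, P z) : ∀ᵐ z ∂μ, ∀ᵐ w ∂(κ z), P w := by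
  apply Measure.ae_ae_of_ae_comp
  rwa [h.comp_eq]

theorem avg_congr {f g : X → ℝ} (hfg : f =ᵐ[μ] g) : avg κ f =ᵐ[μ] avg κ g := by
  filter_upwards [h.ae_ae hfg] with z hz using integral_congr_ae hz

/-- The pull-out property of conditional expectation: `avg κ g` is constant `κ z`-almost surely. -/
theorem avg_mul_avg (f : X → ℝ) {g : X → ℝ} (hg : StronglyMeasurable g) (z : X) :
    avg κ (fun w => f w * avg κ g w) z = avg κ f z * avg κ g z := by
  have : avg κ (fun w => f w * avg κ g w) z = ∫ w, f w * avg κ g z ∂(κ z) :=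
    integral_congr_ae (by filter_upwards [h.ae_avg_eq g hg z] with w hw; rw [hw])
  rw [this, integral_mul_const]
  rfl

theorem ae_integrable {f : X → ℝ} (hf : Integrable f μ) : ∀ᵐ z ∂μ, Integrable f (κ z) := by
  rw [← h.comp_eq] at hf
  exact ((Measure.integrable_comp_iff hf.1).1 hf).1

theorem integrable_avg {f : X → ℝ} (hf : Integrable f μ) : Integrable (avg κ f) μ := by
  have hf' : Integrable f ((κ ∘ₖ Kernel.const Unit μ) ()) := by
    rw [← Measure.comp_eq_comp_const_apply, h.comp_eq]; exact hf
  have := hf'.integral_comp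
  rwa [Kernel.const_apply] at this

theorem integral_avg {f : X → ℝ} (hf : Integrable f μ) : ∫ z, avg κ f z ∂μ = ∫ z, f z ∂μ := by
  have hf' : Integrable f ((κ ∘ₖ Kernel.const Unit μ) ()) := by
    rw [← Measure.comp_eq_comp_const_apply, h.comp_eq]; exact hf
  have := Kernel.integral_comp hf'
  rw [← Measure.comp_eq_comp_const_apply, h.comp_eq, Kernel.const_apply] at this
  exact this.symm

theorem ae_memLp_two {f : X → ℝ} (hf : MemLp f 2 μ) : ∀ᵐ z ∂μ, MemLp f 2 (κ z) := by
  have h1 : ∀ᵐ z ∂μ, AEStronglyMeasurable f (κ z) := by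
    filter_upwards [h.ae_ae hf.1.ae_eq_mk] with z hz using ⟨_, hf.1.stronglyMeasurable_mk, hz⟩
  filter_upwards [h1, h.ae_integrable hf.integrable_sq] with z hz hz'
  exact (memLp_two_iff_integrable_sq hz).2 hz'

theorem integral_abs_avg_le {f : X → ℝ} (hf : Integrable f μ) :
    ∫ z, |avg κ f z| ∂μ ≤ ∫ z, |f z| ∂μ := by
  rw [← h.integral_avg hf.abs]
  exact integral_mono (h.integrable_avg hf).abs (h.integrable_avg hf.abs)
    fun z => abs_integral_le_integral_abs

theorem avg_sub {f g : X → ℝ} (hf : Integrable f μ) (hg : Integrable g μ) :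
    avg κ (fun z => f z - g z) =ᵐ[μ] fun z => avg κ f z - avg κ g z := by
  filter_upwards [h.ae_integrable hf, h.ae_integrable hg] with z h1 h2 using integral_sub h1 h2

end

variable [IsMarkovKernel κ] [IsProbabilityMeasure μ] (h : IsResampling κ μ)
include h

omit [IsProbabilityMeasure μ] in
theorem ae_sq_avg_le {f : X → ℝ} (hf : MemLp f 2 μ) :
    ∀ᵐ z ∂μ, avg κ f z ^ 2 ≤ avg κ (fun w => f w ^ 2) z := by
  filter_upwards [h.ae_memLp_two hf] with z hz using sq_integral_le_integral_sq hz

theorem memLp_two_avg {f : X → ℝ} (hf : MemLp f 2 μ) : MemLp (avg κ f) 2 μ := by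
  have hm := (h.integrable_avg (hf.integrable one_le_two)).1
  rw [memLp_two_iff_integrable_sq hm]
  refine (h.integrable_avg hf.integrable_sq).mono' (hm.pow 2) ?_
  filter_upwards [h.ae_sq_avg_le hf] with z hz
  simpa using hz

/-- Integrating the pull-out property against the invariant measure shows that averaging is an
orthogonal projection in `L²`. -/
theorem integral_mul_avg {f g : X → ℝ} (hf : MemLp f 2 μ) (hg : MemLp g 2 μ) :
    ∫ z, f z * avg κ g z ∂μ = ∫ z, avg κ f z * avg κ g z ∂μ := by
  -- `ae_avg_eq` needs strong measurability; both sides depend only on the class of `g`.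
  wlog hm : StronglyMeasurable g generalizing g
  · have hg' := (memLp_congr_ae hg.1.ae_eq_mk).1 hg
    have h1 := this hg' hg.1.stronglyMeasurable_mk
    have h2 := h.avg_congr hg.1.ae_eq_mk
    have e1 : ∫ z, f z * avg κ g z ∂μ = ∫ z, f z * avg κ (hg.1.mk g) z ∂μ :=
      integral_congr_ae (h2.mono fun z hz => by simp only [hz])
    have e2 : ∫ z, avg κ f z * avg κ g z ∂μ = ∫ z, avg κ f z * avg κ (hg.1.mk g) z ∂μ :=
      integral_congr_ae (h2.mono fun z hz => by simp only [hz])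
    rw [e1, e2, h1]
  have hi : Integrable (fun z => f z * avg κ g z) μ := hf.integrable_mul (h.memLp_two_avg hg)
  rw [← h.integral_avg hi]
  exact integral_congr_ae (ae_of_all _ (h.avg_mul_avg f hm))

/-- Pythagoras for this projection; every telescoping sum below comes from it. -/
theorem integral_sq_sub_avg {f : X → ℝ} (hf : MemLp f 2 μ) :
    ∫ z, (f z - avg κ f z) ^ 2 ∂μ = ∫ z, f z ^ 2 ∂μ - ∫ z, avg κ f z ^ 2 ∂μ := by
  have h1 := h.memLp_two_avg hf
  have h2 : ∫ z, f z * avg κ f z ∂μ = ∫ z, avg κ f z ^ 2 ∂μ := by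
    rw [h.integral_mul_avg hf hf]; simp [sq]
  have h3 : ∀ z, (f z - avg κ f z) ^ 2 = f z ^ 2 - 2 * (f z * avg κ f z) + avg κ f z ^ 2 := by
    intro z; ring
  have i1 : Integrable (fun z => f z * avg κ f z) μ := hf.integrable_mul h1
  have i2 : Integrable (fun z => f z ^ 2 - 2 * (f z * avg κ f z)) μ :=
    hf.integrable_sq.sub (i1.const_mul 2)
  simp_rw [h3]
  rw [integral_add i2 h1.integrable_sq,
    integral_sub hf.integrable_sq (i1.const_mul 2), integral_const_mul, h2]
  ring

end IsResampling

theorem avg_comm [IsProbabilityMeasure μ] [IsMarkovKernel κ] [IsMarkovKernel η]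
    (hκ : IsResampling κ μ) (hη : IsResampling η μ)
    (hc : κ ∘ₖ η = η ∘ₖ κ) {f : X → ℝ} (hf : Integrable f μ) :
    avg κ (avg η f) =ᵐ[μ] avg η (avg κ f) := by
  have h1 : ∀ᵐ z ∂μ, Integrable f ((κ ∘ₖ η) z) := by
    have : (κ ∘ₖ η) ∘ₘ μ = μ := by rw [← Measure.comp_assoc, hη.comp_eq, hκ.comp_eq]
    rw [← this] at hf
    exact ((Measure.integrable_comp_iff hf.1).1 hf).1
  filter_upwards [h1] with z hz
  have e1 := Kernel.integral_comp hz
  rw [hc] at hz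
  have e2 := Kernel.integral_comp hz
  rw [← hc] at e2
  exact e2.symm.trans e1

/-- The iterated average over the kernels `K 0, …, K (n - 1)`. -/
def avgIter (K : ℕ → Kernel X X) : ℕ → (X → ℝ) → X → ℝ
  | 0, f => f
  | n + 1, f => avg (K n) (avgIter K n f)

/-- A commuting family of resampling kernels whose iterated averages converge to the mean. -/
structure IsResamplingFamily (K : ℕ → Kernel X X) (μ : Measure X) : Prop where
  isResampling : ∀ n, IsResampling (K n) μ
  comm : ∀ m n, K m ∘ₖ K n = K n ∘ₖ K m
  tendsto : ∀ u : X → ℝ, MemLp u 2 μ →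
    Tendsto (fun n => ∫ z, (avgIter K n u z - ∫ w, u w ∂μ) ^ 2 ∂μ) atTop (𝓝 0)

variable {K : ℕ → Kernel X X} [∀ n, IsMarkovKernel (K n)] [IsProbabilityMeasure μ]

omit [IsProbabilityMeasure μ] in
theorem stronglyMeasurable_avgIter {f : X → ℝ} (hf : StronglyMeasurable f) (n : ℕ) :
    StronglyMeasurable (avgIter K n f) := by
  induction n with
  | zero => exact hf
  | succ n ih => exact stronglyMeasurable_avg ih

omit [IsProbabilityMeasure μ] in
theorem avgIter_mem_Icc {f : X → ℝ} (hf : StronglyMeasurable f) {a b : ℝ}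
    (hab : ∀ z, f z ∈ Set.Icc a b) (n : ℕ) (z : X) : avgIter K n f z ∈ Set.Icc a b := by
  induction n generalizing z with
  | zero => exact hab z
  | succ n ih =>
    have hi : Integrable (avgIter K n f) (K n z) := by
      refine Integrable.of_bound (stronglyMeasurable_avgIter hf n).aestronglyMeasurable
        (max |a| |b|) (ae_of_all _ fun w => ?_)
      exact abs_le_max_abs_abs (ih w).1 (ih w).2
    constructor
    · calc a = ∫ _, a ∂(K n z) := by simp
        _ ≤ _ := integral_mono (integrable_const _) hi fun w => (ih w).1
    · calc _ ≤ ∫ _, b ∂(K n z) := integral_mono hi (integrable_const _) fun w => (ih w).2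
        _ = b := by simp

section

variable (hr : ∀ n, IsResampling (K n) μ)
include hr

theorem memLp_two_avgIter {f : X → ℝ} (hf : MemLp f 2 μ) (n : ℕ) : MemLp (avgIter K n f) 2 μ := by
  induction n with
  | zero => exact hf
  | succ n ih => exact (hr n).memLp_two_avg ih

omit [∀ n, IsMarkovKernel (K n)] [IsProbabilityMeasure μ] in
theorem integrable_avgIter {f : X → ℝ} (hf : Integrable f μ) (n : ℕ) :
    Integrable (avgIter K n f) μ := by
  induction n with
  | zero => exact hf
  | succ n ih => exact (hr n).integrable_avg ih

omit [∀ n, IsMarkovKernel (K n)] [IsProbabilityMeasure μ] in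
theorem integral_avgIter {f : X → ℝ} (hf : Integrable f μ) (n : ℕ) :
    ∫ z, avgIter K n f z ∂μ = ∫ z, f z ∂μ := by
  induction n with
  | zero => rfl
  | succ n ih => rw [← ih]; exact (hr n).integral_avg (integrable_avgIter hr hf n)

omit [∀ n, IsMarkovKernel (K n)] [IsProbabilityMeasure μ] in
theorem integral_abs_avgIter_le {f : X → ℝ} (hf : Integrable f μ) (n : ℕ) :
    ∫ z, |avgIter K n f z| ∂μ ≤ ∫ z, |f z| ∂μ := by
  induction n with
  | zero => rfl
  | succ n ih => exact ((hr n).integral_abs_avg_le (integrable_avgIter hr hf n)).trans ih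

omit [∀ n, IsMarkovKernel (K n)] [IsProbabilityMeasure μ] in
theorem avgIter_sub {f g : X → ℝ} (hf : Integrable f μ) (hg : Integrable g μ) (n : ℕ) :
    avgIter K n (fun z => f z - g z) =ᵐ[μ] fun z => avgIter K n f z - avgIter K n g z := by
  induction n with
  | zero => rfl
  | succ n ih =>
    exact ((hr n).avg_congr ih).trans
      ((hr n).avg_sub (integrable_avgIter hr hf n) (integrable_avgIter hr hg n))

theorem avgIter_avg (hc : ∀ m n, K m ∘ₖ K n = K n ∘ₖ K m) {f : X → ℝ} (hf : Integrable f μ)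
    (m n : ℕ) : avgIter K n (avg (K m) f) =ᵐ[μ] avg (K m) (avgIter K n f) := by
  induction n with
  | zero => rfl
  | succ n ih =>
    exact ((hr n).avg_congr ih).trans
      (avg_comm (hr n) (hr m) (hc n m) (integrable_avgIter hr hf n))

theorem integral_sq_avgIter_sub {f : X → ℝ} (hf : MemLp f 2 μ) (n : ℕ) :
    ∫ z, (avgIter K n f z - ∫ w, f w ∂μ) ^ 2 ∂μ
      = ∫ z, avgIter K n f z ^ 2 ∂μ - (∫ z, f z ∂μ) ^ 2 := by
  have h2 := memLp_two_avgIter hr hf n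
  have h1 := h2.integrable one_le_two
  have h3 : ∀ z, (avgIter K n f z - ∫ w, f w ∂μ) ^ 2 = avgIter K n f z ^ 2
      - (2 * ∫ w, f w ∂μ) * avgIter K n f z + (∫ w, f w ∂μ) ^ 2 := by intro z; ring
  have i2 : Integrable (fun z => avgIter K n f z ^ 2
      - (2 * ∫ w, f w ∂μ) * avgIter K n f z) μ := h2.integrable_sq.sub (h1.const_mul _)
  simp_rw [h3]
  rw [integral_add i2 (integrable_const _),
    integral_sub h2.integrable_sq (h1.const_mul _), integral_const_mul,
    integral_avgIter hr (hf.integrable one_le_two) n]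
  simp
  ring

end

/-! ### Entropy bounds: tensorization and comparison of `L²` with `L¹`. -/

/-- `E` bounds the entropy of `g ^ 2`, in the dual formulation. -/
def EntBound (μ : Measure X) (g : X → ℝ) (E : ℝ) : Prop :=
  ∀ ψ : X → ℝ, Measurable ψ → (∃ C, ∀ z, |ψ z| ≤ C) →
    ∫ z, g z ^ 2 * ψ z ∂μ ≤ (∫ z, g z ^ 2 ∂μ) * Real.log (∫ z, Real.exp (ψ z) ∂μ) + E

/-- A notion of partial gradients `Γ n` that satisfies a logarithmic Sobolev inequality with
constant `c n` for each kernel `K n`. -/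
structure IsLogSobolev (K : ℕ → Kernel X X) (μ : Measure X) (c : ℕ → ℝ)
    (Γ : ℕ → (X → ℝ) → (X → ℝ) → Prop) : Prop where
  nonneg : ∀ n, 0 ≤ c n
  stronglyMeasurable : ∀ {n g G}, Γ n g G → StronglyMeasurable g
  memLp : ∀ {n g G}, Γ n g G → MemLp g 2 μ
  memLp_grad : ∀ {n g G}, Γ n g G → MemLp G 2 μ
  sub : ∀ {n g g' G G'}, Γ n g G → Γ n g' G' → Γ n (fun z => g z - g' z) (fun z => G z - G' z)
  avg_of_ne : ∀ {m n g G}, m ≠ n → Γ n g G → Γ n (avg (K m) g) (avg (K m) G)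
  avg_self : ∀ {n g G}, Γ n g G → Γ n (avg (K n) g) (fun _ => 0)
  entBound : ∀ {n g G}, Γ n g G → ∀ᵐ z ∂μ, EntBound (K n z) g (c n * ∫ w, G w ^ 2 ∂(K n z))

omit [IsProbabilityMeasure μ] in
theorem integral_sq_mul_le_of_entBound {g G : X → ℝ} {c : ℝ} {κ : Kernel X X} [IsMarkovKernel κ]
    (hκ : IsResampling κ μ) (hg : MemLp g 2 μ) (hG : MemLp G 2 μ)
    (h : ∀ᵐ z ∂μ, EntBound (κ z) g (c * ∫ w, G w ^ 2 ∂(κ z)))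
    {u : X → ℝ} (hu : StronglyMeasurable u) {a b : ℝ} (ha : 0 < a)
    (hab : ∀ z, u z ∈ Set.Icc a b) :
    ∫ z, g z ^ 2 * Real.log (u z) ∂μ
      ≤ ∫ z, g z ^ 2 * Real.log (avg κ u z) ∂μ + c * ∫ z, G z ^ 2 ∂μ := by
  have hu' : StronglyMeasurable (avg κ u) := stronglyMeasurable_avg hu
  have hab' : ∀ z, avg κ u z ∈ Set.Icc a b :=
    fun z => avgIter_mem_Icc (K := fun _ => κ) hu hab 1 z
  have key : ∀ v : X → ℝ, (∀ z, v z ∈ Set.Icc a b) →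
      ∀ z, |Real.log (v z)| ≤ max |Real.log a| |Real.log b| := fun v hv z =>
    abs_le_max_abs_abs (Real.log_le_log ha (hv z).1)
      (Real.log_le_log (ha.trans_le (hv z).1) (hv z).2)
  have hint : ∀ v : X → ℝ, StronglyMeasurable v → (∀ z, v z ∈ Set.Icc a b) →
      Integrable (fun z => g z ^ 2 * Real.log (v z)) μ := fun v hv hv' =>
    hg.integrable_sq.mul_bdd (c := max |Real.log a| |Real.log b|)
      (Real.measurable_log.comp hv.measurable).aestronglyMeasurable (ae_of_all _ (key v hv'))
  have hi1 := hint u hu hab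
  have hi2 := hint _ hu' hab'
  have hle : ∀ᵐ z ∂μ, avg κ (fun w => g w ^ 2 * Real.log (u w)) z
      ≤ avg κ (fun w => g w ^ 2 * Real.log (avg κ u w)) z + c * avg κ (fun w => G w ^ 2) z := by
    filter_upwards [h] with z hz
    have h1 := hz (fun w => Real.log (u w)) (Real.measurable_log.comp hu.measurable)
      ⟨_, key u hab⟩
    -- Under `κ z` the function `avg κ u` is constant, so its logarithm leaves the integral and
    -- becomes the term `log ∫ exp ψ` of `EntBound` for `ψ = log u`.
    have h2 : avg κ (fun w => g w ^ 2 * Real.log (avg κ u w)) z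
        = (∫ w, g w ^ 2 ∂(κ z)) * Real.log (avg κ u z) := by
      rw [← integral_mul_const]
      exact integral_congr_ae (by filter_upwards [hκ.ae_avg_eq u hu z] with w hw; rw [hw])
    have h3 : ∀ w, Real.exp (Real.log (u w)) = u w :=
      fun w => Real.exp_log (ha.trans_le (hab w).1)
    simp_rw [h3] at h1
    rw [h2]
    exact h1
  rw [← hκ.integral_avg hi1, ← hκ.integral_avg hi2, ← hκ.integral_avg hG.integrable_sq,
    ← integral_const_mul, ← integral_add (hκ.integrable_avg hi2)
      ((hκ.integrable_avg hG.integrable_sq).const_mul c)]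
  exact integral_mono_ae (hκ.integrable_avg hi1) ((hκ.integrable_avg hi2).add
      ((hκ.integrable_avg hG.integrable_sq).const_mul c)) hle

/-- Tensorization of the logarithmic Sobolev inequality. -/
theorem IsLogSobolev.entBound_tsum {c : ℕ → ℝ} {Γ : ℕ → (X → ℝ) → (X → ℝ) → Prop}
    (hK : IsResamplingFamily K μ) (hΓ : IsLogSobolev K μ c Γ) {g : X → ℝ} {G : ℕ → X → ℝ}
    (hG : ∀ n, Γ n g (G n)) (hs : Summable fun n => c n * ∫ z, G n z ^ 2 ∂μ) :
    EntBound μ g (∑' n, c n * ∫ z, G n z ^ 2 ∂μ) := by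
  rintro ψ hψ ⟨C, hC⟩
  have hg := hΓ.memLp (hG 0)
  -- Starting from `exp ψ`, one coordinate is averaged out at each step, at the cost of one energy
  -- term. In the limit `u n` becomes the constant `∫ exp ψ`.
  set u : ℕ → X → ℝ := fun n => avgIter K n (fun z => Real.exp (ψ z)) with hu
  have hsm : StronglyMeasurable fun z => Real.exp (ψ z) :=
    (Real.measurable_exp.comp hψ).stronglyMeasurable
  have hI : ∀ z, Real.exp (ψ z) ∈ Set.Icc (Real.exp (-C)) (Real.exp C) := fun z =>
    ⟨Real.exp_le_exp.2 (abs_le.1 (hC z)).1, Real.exp_le_exp.2 (abs_le.1 (hC z)).2⟩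
  have hum : ∀ n, StronglyMeasurable (u n) := stronglyMeasurable_avgIter hsm
  have huI : ∀ n z, u n z ∈ Set.Icc (Real.exp (-C)) (Real.exp C) := avgIter_mem_Icc hsm hI
  have hlog : ∀ n z, |Real.log (u n z)| ≤ C := fun n z => by
    rw [abs_le]
    constructor
    · rw [Real.le_log_iff_exp_le ((Real.exp_pos _).trans_le (huI n z).1)]; exact (huI n z).1
    · rw [Real.log_le_iff_le_exp ((Real.exp_pos _).trans_le (huI n z).1)]; exact (huI n z).2
  have hstep : ∀ n, ∫ z, g z ^ 2 * Real.log (u 0 z) ∂μ ≤ ∫ z, g z ^ 2 * Real.log (u n z) ∂μ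
      + ∑ j ∈ Finset.range n, c j * ∫ z, G j z ^ 2 ∂μ := by
    intro n
    induction n with
    | zero => simp
    | succ n ih =>
      have := integral_sq_mul_le_of_entBound (hK.isResampling n) hg (hΓ.memLp_grad (hG n))
        (hΓ.entBound (hG n)) (hum n) (Real.exp_pos _) (huI n)
      rw [Finset.sum_range_succ]
      change _ ≤ ∫ z, g z ^ 2 * Real.log (u (n + 1) z) ∂μ + _ at this
      linarith
  have hle : ∀ n, ∫ z, g z ^ 2 * ψ z ∂μ ≤ ∫ z, g z ^ 2 * Real.log (u n z) ∂μ
      + ∑' n, c n * ∫ z, G n z ^ 2 ∂μ := fun n => by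
    have h1 := hstep n
    simp only [hu, avgIter, Real.log_exp] at h1
    have h2 : ∑ j ∈ Finset.range n, c j * ∫ z, G j z ^ 2 ∂μ ≤ ∑' n, c n * ∫ z, G n z ^ 2 ∂μ :=
      hs.sum_le_tsum _ fun j _ => mul_nonneg (hΓ.nonneg j) (integral_nonneg fun z => sq_nonneg _)
    linarith
  have hmem : MemLp (fun z => Real.exp (ψ z)) 2 μ :=
    MemLp.of_bound hsm.aestronglyMeasurable (Real.exp C) (ae_of_all _ fun z => by
      rw [Real.norm_eq_abs, Real.abs_exp]; exact (hI z).2)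
  set m := ∫ z, Real.exp (ψ z) ∂μ with hm
  have hmpos : 0 < m := integral_exp_pos (hmem.integrable one_le_two)
  -- `L²` convergence gives almost everywhere convergence along a subsequence; this suffices, since
  -- `|log (u n)| ≤ C` allows dominated convergence against `g²`.
  have htm : TendstoInMeasure μ u atTop (fun _ => m) := by
    refine tendstoInMeasure_of_tendsto_eLpNorm (p := 2) (by norm_num)
      (fun n => (hum n).aestronglyMeasurable) aestronglyMeasurable_const ?_
    have h0 : ∀ n, eLpNorm (u n - fun _ => m) 2 μ
        = ENNReal.ofReal (√(∫ z, (u n z - m) ^ 2 ∂μ)) := fun n =>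
      eLpNorm_two_eq_ofReal_sqrt ((memLp_two_avgIter hK.isResampling hmem n).sub (memLp_const m))
    simp_rw [h0]
    have := (ENNReal.continuous_ofReal.comp Real.continuous_sqrt).continuousAt.tendsto.comp
      (hK.tendsto _ hmem)
    simpa [Function.comp_def] using this
  obtain ⟨ns, -, hns⟩ := htm.exists_seq_tendsto_ae
  have hlim : Tendsto (fun k => ∫ z, g z ^ 2 * Real.log (u (ns k) z) ∂μ) atTop
      (𝓝 (∫ z, g z ^ 2 * Real.log m ∂μ)) := by
    refine tendsto_integral_of_dominated_convergence (fun z => g z ^ 2 * C) (fun k => ?_)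
      (hg.integrable_sq.mul_const C) (fun k => ae_of_all _ fun z => ?_) ?_
    · exact (hg.1.pow 2).mul (Real.measurable_log.comp (hum _).measurable).aestronglyMeasurable
    · rw [norm_mul, Real.norm_eq_abs, Real.norm_eq_abs, abs_of_nonneg (sq_nonneg _)]
      exact mul_le_mul_of_nonneg_left (hlog _ z) (sq_nonneg _)
    · filter_upwards [hns] with z hz
      exact (hz.log hmpos.ne').const_mul _
  rw [integral_mul_const] at hlim
  exact ge_of_tendsto (hlim.add_const _) (Eventually.of_forall fun k => hle (ns k))

/-- An entropy bound implies a bound of the `L²` norm in terms of the `L¹` norm. -/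
theorem EntBound.integral_sq_mul_le {g : X → ℝ} {E : ℝ} (h : EntBound μ g E)
    (hg : StronglyMeasurable g) (hg2 : MemLp g 2 μ) {t : ℝ} (ht : 0 < t) :
    (∫ z, g z ^ 2 ∂μ) * (1 + Real.log t) ≤ E + t * (∫ z, |g z| ∂μ) ^ 2 := by
  have hi := hg2.integrable one_le_two
  set A := ∫ z, |g z| ∂μ with hA
  have hA0 : 0 ≤ A := integral_nonneg fun z => abs_nonneg _
  -- The ideal test function is `ψ = log |g|`, which may be unbounded in both directions. It is
  -- truncated from below at `ε`, which tends to `0` at the end.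
  have key : ∀ ε > 0, (∫ z, g z ^ 2 ∂μ) * (1 + Real.log t) ≤ E + t * (A + ε) * A := by
    intro ε hε
    set s := t * (A + ε) with hs
    have hs0 : 0 < s := by positivity
    -- The upper truncation costs nothing: `log M ≥ 1 + log s`, which is all that is needed where `v
    -- = M`.
    set M := max ε (s * Real.exp 1) with hM
    set v : X → ℝ := fun z => min (max |g z| ε) M with hv
    have hvm : Measurable v := ((hg.measurable.abs).max measurable_const).min measurable_const
    have hv1 : ∀ z, ε ≤ v z := fun z => le_min (le_max_right _ _) (le_max_left _ _)
    have hv2 : ∀ z, v z ≤ M := fun z => min_le_right _ _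
    have hv3 : ∀ z, v z ≤ |g z| + ε := fun z =>
      (min_le_left _ _).trans (max_le (by linarith) (by linarith [abs_nonneg (g z)]))
    have hv0 : ∀ z, 0 < v z := fun z => hε.trans_le (hv1 z)
    have hlog : ∀ z, |Real.log (v z)| ≤ max |Real.log ε| |Real.log M| := fun z =>
      abs_le_max_abs_abs (Real.log_le_log hε (hv1 z)) (Real.log_le_log (hv0 z) (hv2 z))
    have h1 := h (fun z => Real.log (v z)) (Real.measurable_log.comp hvm) ⟨_, hlog⟩
    simp_rw [Real.exp_log (hv0 _)] at h1
    have hvi : Integrable v μ := (hi.abs.add (integrable_const ε)).mono' hvm.aestronglyMeasurable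
      (ae_of_all _ fun z => by
        rw [Real.norm_eq_abs, abs_of_pos (hv0 z)]; exact hv3 z)
    have h2 : ∫ z, v z ∂μ ≤ A + ε := by
      calc ∫ z, v z ∂μ ≤ ∫ z, (|g z| + ε) ∂μ :=
            integral_mono hvi (hi.abs.add (integrable_const ε)) hv3
        _ = A + ε := by rw [integral_add hi.abs (integrable_const ε)]; simp [hA]
    have h2' : 0 < ∫ z, v z ∂μ := by
      have : ∫ _, ε ∂μ ≤ ∫ z, v z ∂μ := integral_mono (integrable_const ε) hvi hv1
      simp at this
      linarith
    have h3 : Real.log (∫ z, v z ∂μ) ≤ Real.log (A + ε) := Real.log_le_log h2' h2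
    -- From `log x ≤ x - 1` at `x = s / |g|`, multiplied by `g²`.
    have h4 : ∀ z, g z ^ 2 * (1 + Real.log s) - s * |g z| ≤ g z ^ 2 * Real.log (v z) := by
      intro z
      rcases eq_or_ne (g z) 0 with h0 | h0
      · simp [h0]
      have hpos : 0 < |g z| := abs_pos.2 h0
      have : 1 + Real.log s - s / |g z| ≤ Real.log (v z) := by
        rcases le_total (max |g z| ε) M with hc | hc
        · have e : v z = max |g z| ε := min_eq_left hc
          have l1 : Real.log |g z| ≤ Real.log (v z) :=
            Real.log_le_log hpos (by rw [e]; exact le_max_left _ _)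
          have l2 := Real.log_le_sub_one_of_pos (div_pos hs0 hpos)
          rw [Real.log_div hs0.ne' hpos.ne'] at l2
          linarith
        · have e : v z = M := min_eq_right hc
          have l1 : Real.log (s * Real.exp 1) ≤ Real.log (v z) :=
            Real.log_le_log (by positivity) (by rw [e]; exact le_max_right _ _)
          rw [Real.log_mul hs0.ne' (Real.exp_pos 1).ne', Real.log_exp] at l1
          have : 0 < s / |g z| := by positivity
          linarith
      have h5 := mul_le_mul_of_nonneg_left this (sq_nonneg (g z))
      have h6 : g z ^ 2 * (1 + Real.log s - s / |g z|)
          = g z ^ 2 * (1 + Real.log s) - s * |g z| := by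
        rw [← sq_abs]; field_simp
      linarith
    have h5 : (∫ z, g z ^ 2 ∂μ) * (1 + Real.log s) - s * A ≤ ∫ z, g z ^ 2 * Real.log (v z) ∂μ := by
      rw [hA, ← integral_mul_const, ← integral_const_mul,
        ← integral_sub (hg2.integrable_sq.mul_const _) (hi.abs.const_mul s)]
      refine integral_mono ((hg2.integrable_sq.mul_const _).sub (hi.abs.const_mul s)) ?_ h4
      exact hg2.integrable_sq.mul_bdd (Real.measurable_log.comp hvm).aestronglyMeasurable
        (ae_of_all _ hlog)
    have h6 : Real.log s = Real.log t + Real.log (A + ε) :=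
      Real.log_mul ht.ne' (by positivity)
    have h7 : 0 ≤ ∫ z, g z ^ 2 ∂μ := integral_nonneg fun z => sq_nonneg _
    rw [h6] at h5
    nlinarith [mul_le_mul_of_nonneg_left h3 h7]
  have hlim : Tendsto (fun ε : ℝ => E + t * (A + ε) * A) (𝓝[>] 0) (𝓝 (E + t * (A + 0) * A)) := by
    apply Tendsto.mono_left _ nhdsWithin_le_nhds
    exact Continuous.tendsto (by fun_prop) 0
  have := ge_of_tendsto hlim (eventually_mem_nhdsWithin.mono fun ε hε => key ε hε)
  calc _ ≤ _ := this
    _ = _ := by ring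

/-! ### Orthogonal increments and the abstract variance inequality. -/

/-- The partial gradient in direction `j` of the iterated average over `K 0, …, K (n - 1)`. -/
def gradIter (K : ℕ → Kernel X X) (j : ℕ) (G : X → ℝ) : ℕ → X → ℝ
  | 0 => G
  | n + 1 => if n = j then fun _ => 0 else avg (K n) (gradIter K j G n)

section

variable {c : ℕ → ℝ} {Γ : ℕ → (X → ℝ) → (X → ℝ) → Prop}

omit [∀ n, IsMarkovKernel (K n)] [IsProbabilityMeasure μ] in
theorem IsLogSobolev.grad_avgIter (hΓ : IsLogSobolev K μ c Γ) {g G : X → ℝ} {j : ℕ} (hG : Γ j g G)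
    (n : ℕ) : Γ j (avgIter K n g) (gradIter K j G n) := by
  induction n with
  | zero => exact hG
  | succ n ih =>
    unfold gradIter
    split_ifs with h
    · subst h
      exact hΓ.avg_self ih
    · exact hΓ.avg_of_ne h ih

/-- For `n ≠ j` this is Pythagoras; at `n = j` the next gradient is zero. Hence the energies
telescope in every direction. -/
theorem integral_sq_gradIter_sub (hr : ∀ n, IsResampling (K n) μ) {G : X → ℝ} {j n : ℕ}
    (hG : MemLp (gradIter K j G n) 2 μ) :
    ∫ z, (gradIter K j G n z - gradIter K j G (n + 1) z) ^ 2 ∂μ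
      = ∫ z, gradIter K j G n z ^ 2 ∂μ - ∫ z, gradIter K j G (n + 1) z ^ 2 ∂μ := by
  by_cases h : n = j
  · simp [gradIter, h]
  · simp only [gradIter, h, if_false]
    exact (hr n).integral_sq_sub_avg hG

theorem IsLogSobolev.variance_mul_le (hK : IsResamplingFamily K μ) (hΓ : IsLogSobolev K μ c Γ)
    {f : X → ℝ} {G : ℕ → X → ℝ} (hG : ∀ n, Γ n f (G n))
    (hs : Summable fun n => c n * ∫ z, G n z ^ 2 ∂μ) {D : ℝ}
    (hD : ∀ N, ∑ n ∈ Finset.range N, (∫ z, |f z - avg (K n) f z| ∂μ) ^ 2 ≤ D)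
    {t : ℝ} (ht : 0 < t) :
    (∫ z, f z ^ 2 ∂μ - (∫ z, f z ∂μ) ^ 2) * (1 + Real.log t)
      ≤ ∑' n, c n * ∫ z, G n z ^ 2 ∂μ + t * D := by
  have hr := hK.isResampling
  have hf := hΓ.memLp (hG 0)
  have hf1 := hf.integrable one_le_two
  have hgrad : ∀ n j, MemLp (gradIter K j (G j) n) 2 μ := fun n j =>
    hΓ.memLp_grad (hΓ.grad_avgIter (hG j) n)
  have hstep : ∀ n j, ∫ z, (gradIter K j (G j) n z - gradIter K j (G j) (n + 1) z) ^ 2 ∂μ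
      = ∫ z, gradIter K j (G j) n z ^ 2 ∂μ - ∫ z, gradIter K j (G j) (n + 1) z ^ 2 ∂μ :=
    fun n j => integral_sq_gradIter_sub hr (hgrad n j)
  set a : ℕ → ℕ → ℝ := fun n j => c j * ∫ z, gradIter K j (G j) n z ^ 2 ∂μ with ha
  have ha0 : ∀ n j, 0 ≤ a n j := fun n j =>
    mul_nonneg (hΓ.nonneg j) (integral_nonneg fun z => sq_nonneg _)
  have hmono : ∀ n j, a (n + 1) j ≤ a n j := fun n j => by
    apply mul_le_mul_of_nonneg_left _ (hΓ.nonneg j)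
    have : 0 ≤ ∫ z, (gradIter K j (G j) n z - gradIter K j (G j) (n + 1) z) ^ 2 ∂μ :=
      integral_nonneg fun z => sq_nonneg _
    rw [hstep] at this
    linarith
  have hsum : ∀ n, Summable (a n) := by
    intro n
    induction n with
    | zero => exact hs
    | succ n ih => exact ih.of_nonneg_of_le (ha0 _) (hmono n)
  -- The entropy bound and the `L²`–`L¹` comparison, both applied to the increment `d`. Each term
  -- except the last is a difference of consecutive values.
  have hincr : ∀ n, (∫ z, avgIter K n f z ^ 2 ∂μ - ∫ z, avgIter K (n + 1) f z ^ 2 ∂μ)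
      * (1 + Real.log t) ≤ ∑' j, a n j - ∑' j, a (n + 1) j
        + t * (∫ z, |f z - avg (K n) f z| ∂μ) ^ 2 := by
    intro n
    set d : X → ℝ := fun z => avgIter K n f z - avgIter K (n + 1) f z with hd
    have hdG : ∀ j, Γ j d (fun z => gradIter K j (G j) n z - gradIter K j (G j) (n + 1) z) :=
      fun j => hΓ.sub (hΓ.grad_avgIter (hG j) n) (hΓ.grad_avgIter (hG j) (n + 1))
    have e1 : ∀ j, c j * ∫ z, (gradIter K j (G j) n z - gradIter K j (G j) (n + 1) z) ^ 2 ∂μ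
        = a n j - a (n + 1) j := fun j => by rw [hstep, mul_sub]
    have hsd : Summable fun j =>
        c j * ∫ z, (gradIter K j (G j) n z - gradIter K j (G j) (n + 1) z) ^ 2 ∂μ := by
      simp_rw [e1]
      exact (hsum n).sub (hsum (n + 1))
    have h1 := (hΓ.entBound_tsum hK hdG hsd).integral_sq_mul_le
      (hΓ.stronglyMeasurable (hdG 0)) (hΓ.memLp (hdG 0)) ht
    simp_rw [e1] at h1
    rw [(hsum n).tsum_sub (hsum (n + 1))] at h1
    have h2 : ∫ z, d z ^ 2 ∂μ = ∫ z, avgIter K n f z ^ 2 ∂μ - ∫ z, avgIter K (n + 1) f z ^ 2 ∂μ :=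
      (hr n).integral_sq_sub_avg (memLp_two_avgIter hr hf n)
    rw [h2] at h1
    -- Commuting `K n` past the earlier kernels presents `d` as an average of `f - avg (K n) f`, so
    -- its `L¹` norm is no larger.
    have h3 : d =ᵐ[μ] avgIter K n (fun z => f z - avg (K n) f z) := by
      filter_upwards [avgIter_sub hr hf1 ((hr n).integrable_avg hf1) n,
        avgIter_avg hr hK.comm hf1 n n] with z h4 h5
      rw [h4, h5]
      rfl
    have h4 : ∫ z, |d z| ∂μ ≤ ∫ z, |f z - avg (K n) f z| ∂μ := by
      have e : ∫ z, |d z| ∂μ = ∫ z, |avgIter K n (fun z => f z - avg (K n) f z) z| ∂μ :=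
        integral_congr_ae (by filter_upwards [h3] with z hz; rw [hz])
      rw [e]
      exact integral_abs_avgIter_le hr (hf1.sub ((hr n).integrable_avg hf1)) n
    have h5 : (∫ z, |d z| ∂μ) ^ 2 ≤ (∫ z, |f z - avg (K n) f z| ∂μ) ^ 2 :=
      pow_le_pow_left₀ (integral_nonneg fun z => abs_nonneg _) h4 2
    have h6 := mul_le_mul_of_nonneg_left h5 ht.le
    linarith
  have htot : ∀ N, (∫ z, f z ^ 2 ∂μ - ∫ z, avgIter K N f z ^ 2 ∂μ) * (1 + Real.log t)
      ≤ ∑' j, a 0 j - ∑' j, a N j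
        + t * ∑ n ∈ Finset.range N, (∫ z, |f z - avg (K n) f z| ∂μ) ^ 2 := by
    intro N
    induction N with
    | zero => simp [avgIter]
    | succ N ih =>
      rw [Finset.sum_range_succ]
      have := hincr N
      nlinarith
  have hle : ∀ N, (∫ z, f z ^ 2 ∂μ - ∫ z, avgIter K N f z ^ 2 ∂μ) * (1 + Real.log t)
      ≤ ∑' n, c n * ∫ z, G n z ^ 2 ∂μ + t * D := by
    intro N
    have h1 := htot N
    have h2 : 0 ≤ ∑' j, a N j := tsum_nonneg (ha0 N)
    have h3 := mul_le_mul_of_nonneg_left (hD N) ht.le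
    change _ ≤ ∑' j, a 0 j + _
    linarith
  -- Convergence of the iterated averages to the mean turns the telescoped left side into the full
  -- variance.
  have hlim : Tendsto (fun N => ∫ z, avgIter K N f z ^ 2 ∂μ) atTop (𝓝 ((∫ z, f z ∂μ) ^ 2)) := by
    have h1 := (hK.tendsto f hf).add_const ((∫ z, f z ∂μ) ^ 2)
    simp_rw [integral_sq_avgIter_sub hr hf] at h1
    simpa using h1
  exact le_of_tendsto ((hlim.const_sub _).mul_const _) (Eventually.of_forall hle)

end

end BernoulliGauss

end

/-! ### The two-point logarithmic Sobolev inequality. -/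

noncomputable section

namespace BernoulliGauss

/-- The logarithmic mean of `exp u` and `exp v`. -/
def logMean (u v : ℝ) : ℝ := ∫ θ in (0 : ℝ)..1, Real.exp (θ * u + (1 - θ) * v)

theorem logMean_comm (u v : ℝ) : logMean u v = logMean v u := by
  have := intervalIntegral.integral_comp_sub_left (a := 0) (b := 1)
    (fun θ : ℝ => Real.exp (θ * v + (1 - θ) * u)) 1
  simp only [sub_zero, sub_self] at this
  unfold logMean
  rw [← this]
  congr 1 with θ
  ring_nf

/-- The integral form avoids the quotient `(exp u - exp v) / (u - v)` and its exceptional case `u =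
v`. -/
theorem logMean_mul_sub (u v : ℝ) : logMean u v * (u - v) = Real.exp u - Real.exp v := by
  have hd : ∀ θ ∈ Set.uIcc (0 : ℝ) 1, HasDerivAt (fun θ : ℝ => Real.exp (θ * u + (1 - θ) * v))
      (Real.exp (θ * u + (1 - θ) * v) * (u - v)) θ := by
    intro θ _
    have h1 : HasDerivAt (fun θ : ℝ => θ * u + (1 - θ) * v) (u - v) θ := by
      have := ((hasDerivAt_id θ).mul_const u).add (((hasDerivAt_id θ).const_sub 1).mul_const v)
      convert! this using 1
      ring
    exact h1.exp
  have := intervalIntegral.integral_eq_sub_of_hasDerivAt hd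
    (Continuous.intervalIntegrable (by fun_prop) _ _)
  rw [intervalIntegral.integral_mul_const] at this
  simpa [logMean] using this

theorem logMean_self (u : ℝ) : logMean u u = Real.exp u := by
  unfold logMean
  have : ∀ θ : ℝ, θ * u + (1 - θ) * u = u := fun θ => by ring
  simp [this]

theorem logMean_add_add (u v w : ℝ) : logMean (u + w) (v + w) = Real.exp w * logMean u v := by
  unfold logMean
  rw [← intervalIntegral.integral_const_mul]
  congr 1 with θ
  rw [← Real.exp_add]
  ring_nf

theorem logMean_pos (u v : ℝ) : 0 < logMean u v :=
  intervalIntegral.intervalIntegral_pos_of_pos (Continuous.intervalIntegrable (by fun_prop) _ _)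
    (fun _ => Real.exp_pos _) one_pos

/-- Superadditivity of the logarithmic mean. -/
theorem logMean_add_logMean_le {x₁ y₁ x₂ y₂ : ℝ} (hx₁ : 0 < x₁) (hy₁ : 0 < y₁) (hx₂ : 0 < x₂)
    (hy₂ : 0 < y₂) :
    logMean (Real.log x₁) (Real.log y₁) + logMean (Real.log x₂) (Real.log y₂)
      ≤ logMean (Real.log (x₁ + x₂)) (Real.log (y₁ + y₂)) := by
  unfold logMean
  have hi : ∀ u v : ℝ, IntervalIntegrable (fun θ : ℝ => Real.exp (θ * u + (1 - θ) * v))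
      volume 0 1 := fun u v => Continuous.intervalIntegrable (by fun_prop) _ _
  rw [← intervalIntegral.integral_add (hi _ _) (hi _ _)]
  refine intervalIntegral.integral_mono_on zero_le_one ((hi _ _).add (hi _ _)) (hi _ _) ?_
  intro θ hθ
  -- Weighted AM–GM for the fractions `x / (x₁ + x₂)` and `y / (y₁ + y₂)`. Over the two pairs the
  -- arithmetic means add up to `1`, so `x ^ θ * y ^ (1 - θ)` is superadditive for each `θ`.
  have key : ∀ x y : ℝ, 0 < x → 0 < y → Real.exp (θ * Real.log x + (1 - θ) * Real.log y)
      ≤ Real.exp (θ * Real.log (x₁ + x₂) + (1 - θ) * Real.log (y₁ + y₂))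
        * (θ * (x / (x₁ + x₂)) + (1 - θ) * (y / (y₁ + y₂))) := by
    intro x y hx hy
    have h1 := Real.geom_mean_le_arith_mean2_weighted hθ.1 (sub_nonneg.2 hθ.2)
      (show 0 ≤ x / (x₁ + x₂) by positivity) (show 0 ≤ y / (y₁ + y₂) by positivity) (by ring)
    refine le_trans (le_of_eq ?_) (mul_le_mul_of_nonneg_left h1 (Real.exp_pos _).le)
    rw [Real.rpow_def_of_pos (by positivity), Real.rpow_def_of_pos (by positivity),
      ← Real.exp_add, ← Real.exp_add, Real.log_div hx.ne' (by positivity),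
      Real.log_div hy.ne' (by positivity)]
    ring_nf
  have h1 := key x₁ y₁ hx₁ hy₁
  have h2 := key x₂ y₂ hx₂ hy₂
  have h3 : (θ * (x₁ / (x₁ + x₂)) + (1 - θ) * (y₁ / (y₁ + y₂)))
      + (θ * (x₂ / (x₁ + x₂)) + (1 - θ) * (y₂ / (y₁ + y₂))) = 1 := by
    field_simp
    ring
  calc _ ≤ _ := add_le_add h1 h2
    _ = _ := by rw [← mul_add, h3, mul_one]

/-- The constant is the reciprocal of the logarithmic mean of `p` and `1 - p`; the two-point
inequality uses it only in this form. -/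
theorem cLS_mul_logMean {p : ℝ} (hp : 0 < p) (hp' : p < 1) :
    cLS p * logMean (Real.log p) (Real.log (1 - p)) = 1 := by
  unfold cLS
  split_ifs with h
  · subst h
    norm_num [logMean_self, Real.exp_log]
  · have h1 := logMean_mul_sub (Real.log p) (Real.log (1 - p))
    rw [Real.exp_log hp, Real.exp_log (by linarith)] at h1
    have h2 : p - (1 - p) ≠ 0 := fun h3 => h (by linarith)
    rw [div_mul_eq_mul_div, mul_comm, h1, div_self h2]

theorem cLS_pos {p : ℝ} (hp : 0 < p) (hp' : p < 1) : 0 < cLS p :=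
  pos_of_mul_pos_left (by rw [cLS_mul_logMean hp hp']; exact one_pos) (logMean_pos _ _).le

/-- The two-point logarithmic Sobolev inequality when the first weight is at least one. -/
theorem two_point_of_nonneg {p q c A B : ℝ} (hp : 0 < p) (hq : 0 < q) (hpq : p + q = 1)
    (hc : c * logMean (Real.log p) (Real.log q) = 1) (hA : 0 ≤ A)
    (hAB : q * Real.exp A + p * Real.exp B = 1) (a b : ℝ) :
    q * a ^ 2 * A + p * b ^ 2 * B ≤ c * (p * q * (a - b) ^ 2) := by
  have hc0 : 0 < c := pos_of_mul_pos_left (by rw [hc]; exact one_pos) (logMean_pos _ _).le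
  rcases hA.eq_or_lt with rfl | hA
  · have hB : B = 0 := by
      have h1 : p * Real.exp B = p := by rw [Real.exp_zero] at hAB; linarith
      exact Real.exp_eq_one_iff B |>.1 (mul_left_cancel₀ hp.ne' (h1.trans (mul_one p).symm))
    subst hB
    have : 0 ≤ c * (p * q * (a - b) ^ 2) := by positivity
    simpa using this
  set r := Real.exp A with hr
  set s := Real.exp B with hs
  have hr1 : 1 < r := Real.one_lt_exp_iff.2 hA
  have hs0 : 0 < s := Real.exp_pos B
  have hs1 : s < 1 := by nlinarith
  have hB : B < 0 := Real.exp_lt_one_iff.1 hs1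
  have e1 : r - 1 = p * (r - s) := by linear_combination hAB - r * hpq
  have e2 : 1 - s = q * (r - s) := by linear_combination s * hpq - hAB
  have hrs : 0 < r - s := by linarith
  have l1 : logMean A 0 * A = r - 1 := by simpa using logMean_mul_sub A 0
  have l2 : logMean 0 B * (-B) = 1 - s := by simpa using logMean_mul_sub 0 B
  -- Superadditivity for the decomposition `(r, 1) = (1, s) + (r - 1, 1 - s)`. The last pair is `(r
  -- - s)` times `(p, q)`, so its mean is `(r - s) / c`.
  have l3 := logMean_add_logMean_le one_pos hs0 (sub_pos.2 hr1) (sub_pos.2 hs1)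
  rw [add_sub_cancel, add_sub_cancel, Real.log_one, e1, e2, Real.log_mul hp.ne' hrs.ne',
    Real.log_mul hq.ne' hrs.ne', logMean_add_add, Real.exp_log hrs, hr, hs, Real.log_exp,
    Real.log_exp, ← hr, ← hs] at l3
  set L := logMean (Real.log p) (Real.log q) with hL
  -- This is the determinant condition for the quadratic form in `(a, b)` given by right side minus
  -- left side; `hPQ` is the same inequality rearranged.
  have key : c * (p * B + q * A) ≤ A * B := by
    have h1 : logMean 0 B * (-B) * A + (r - s) * L * (A * (-B)) ≤ logMean A 0 * A * (-B) := by
      have := mul_le_mul_of_nonneg_right l3 (mul_pos hA (neg_pos.2 hB)).le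
      linarith
    rw [l1, l2, e1, e2] at h1
    have h2 : q * A + L * (A * (-B)) ≤ p * (-B) := by
      refine le_of_mul_le_mul_left ?_ hrs
      linarith
    have h3 := mul_le_mul_of_nonneg_left h2 hc0.le
    have h4 : c * (q * A + L * (A * (-B))) = c * q * A + (c * L) * (A * (-B)) := by ring
    rw [h4, hc] at h3
    linarith
  have hQ : 0 < c * q - B := by nlinarith [mul_pos hc0 hq]
  have hPQ : c ^ 2 * (p * q) ≤ (c * p - A) * (c * q - B) := by nlinarith
  have hP : 0 < c * p - A := pos_of_mul_pos_left
    (lt_of_lt_of_le (by positivity) hPQ) hQ.le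
  -- Completing the square: the product is `h2`'s square plus `p * q * b ^ 2` times the slack in
  -- `hPQ`.
  have hfin : 0 ≤ (c * p - A) * q * (c * (p * q * (a - b) ^ 2) - (q * a ^ 2 * A + p * b ^ 2 * B)) := by
    have h1 := mul_le_mul_of_nonneg_left hPQ (show 0 ≤ p * q * b ^ 2 by positivity)
    have h2 := sq_nonneg (q * a * (c * p - A) - c * p * q * b)
    nlinarith
  have := nonneg_of_mul_nonneg_right hfin (mul_pos hP hq)
  linarith

/-- The logarithmic Sobolev inequality of the Bernoulli measure, in the dual formulation. -/
theorem two_point {p A B : ℝ} (hp : 0 < p) (hp' : p < 1)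
    (hAB : (1 - p) * Real.exp A + p * Real.exp B = 1) (a b : ℝ) :
    (1 - p) * a ^ 2 * A + p * b ^ 2 * B ≤ cLS p * (p * (1 - p) * (a - b) ^ 2) := by
  have hq : 0 < 1 - p := by linarith
  have hc := cLS_mul_logMean hp hp'
  rcases le_total 0 A with hA | hA
  · exact two_point_of_nonneg hp hq (by ring) hc hA hAB a b
  · have hB : 0 ≤ B := by
      by_contra! hB
      have h1 := mul_le_mul_of_nonneg_left (Real.exp_le_one_iff.2 hA) hq.le
      have h2 := mul_lt_mul_of_pos_left (Real.exp_lt_one_iff.2 hB) hp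
      linarith
    have := two_point_of_nonneg hq hp (by ring) (by rwa [logMean_comm]) hB
      (by rwa [add_comm]) b a
    have e : (b - a) ^ 2 = (a - b) ^ 2 := by ring
    rw [e] at this
    linarith

theorem entBound_ber {p : I} (hp0 : 0 < p) (hp1 : p < 1) (g : Bool → ℝ) :
    EntBound (ber p) g (cLS p * ∫ b, (g b - ∫ b', g b' ∂(ber p)) ^ 2 ∂(ber p)) := by
  intro ψ _ _
  have hp : (0 : ℝ) < p := hp0
  have hp' : (p : ℝ) < 1 := hp1
  have hq : (0 : ℝ) < 1 - p := by linarith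
  simp only [ber, integral_bernoulliMeasure, smul_eq_mul]
  -- Subtracting `log m` from `ψ` normalizes its exponential to mean one, as `two_point` requires.
  set m := (p : ℝ) * Real.exp (ψ true) + (1 - p : ℝ) * Real.exp (ψ false) with hm
  have hm0 : 0 < m := by positivity
  have h1 : (1 - p : ℝ) * Real.exp (ψ false - Real.log m) + p * Real.exp (ψ true - Real.log m)
      = 1 := by
    rw [Real.exp_sub, Real.exp_sub, Real.exp_log hm0]
    field_simp
    rw [hm]
    ring
  have h2 := two_point hp hp' h1 (g false) (g true)
  have h3 : (p : ℝ) * (g true - (p * g true + (1 - p) * g false)) ^ 2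
      + (1 - p) * (g false - (p * g true + (1 - p) * g false)) ^ 2
      = p * (1 - p) * (g false - g true) ^ 2 := by ring
  rw [h3]
  linarith

end BernoulliGauss

end

/-! ### Weakly differentiable functions on the line are primitives. -/

noncomputable section

namespace BernoulliGauss

open Filter Topology

theorem exists_tsupport_subset_Ioo {k : ℝ → ℝ} (hk : HasCompactSupport k) :
    ∃ R > 0, tsupport k ⊆ Set.Ioo (-R) R := by
  obtain ⟨R, hR⟩ := hk.isCompact.isBounded.subset_ball 0
  refine ⟨max R 1, by positivity, fun x hx => ?_⟩
  have h1 := hR hx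
  rw [Real.ball_eq_Ioo] at h1
  exact ⟨by linarith [h1.1, le_max_left R 1], by linarith [h1.2, le_max_left R 1]⟩

theorem intervalIntegral_eq_integral_of_support_subset_Ioo {k : ℝ → ℝ} {R : ℝ}
    (hk : Function.support k ⊆ Set.Ioo (-R) R) : ∫ x in (-R)..R, k x = ∫ x, k x :=
  intervalIntegral.integral_eq_integral_of_support_subset (hk.trans Set.Ioo_subset_Ioc_self)

theorem intervalIntegrable_of_locallyIntegrable {h : ℝ → ℝ}
    (hh : LocallyIntegrable h) (a b : ℝ) : IntervalIntegrable h volume a b :=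
  (hh.integrableOn_isCompact isCompact_uIcc).intervalIntegrable

/-- Integration by parts for absolutely continuous functions; the primitive has derivative `h`
almost everywhere, and `η` vanishes at both ends. -/
theorem integral_deriv_mul_primitive {h : ℝ → ℝ} (hh : LocallyIntegrable h) {η : ℝ → ℝ}
    (hη : ContDiff ℝ ∞ η) (hc : HasCompactSupport η) :
    ∫ x, deriv η x * ∫ t in (0 : ℝ)..x, h t = - ∫ x, η x * h x := by
  obtain ⟨R, hR, hz⟩ := exists_tsupport_subset_Ioo hc
  have hi := intervalIntegrable_of_locallyIntegrable hh (-R) R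
  have h0 : (0 : ℝ) ∈ Set.uIcc (-R) R := by
    rw [Set.uIcc_of_le (by linarith)]; exact ⟨by linarith, hR.le⟩
  have hη' : AbsolutelyContinuousOnInterval η (-R) R :=
    (hη.of_le (by exact_mod_cast le_top)).contDiffOn.absolutelyContinuousOnInterval
  have h1 := hη'.integral_mul_deriv_eq_deriv_mul
    (hi.absolutelyContinuousOnInterval_intervalIntegral h0)
  have h2 : ∫ x in (-R)..R, η x * deriv (fun x => ∫ t in (0 : ℝ)..x, h t) x
      = ∫ x in (-R)..R, η x * h x := by
    apply intervalIntegral.integral_congr_ae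
    filter_upwards [LocallyIntegrable.ae_hasDerivAt_integral hh] with x hx _
    rw [(hx 0).deriv]
  have e1 : η R = 0 := image_eq_zero_of_notMem_tsupport fun h => (hz h).2.false
  have e2 : η (-R) = 0 := image_eq_zero_of_notMem_tsupport fun h => (hz h).1.false
  rw [h2, e1, e2, intervalIntegral_eq_integral_of_support_subset_Ioo,
    intervalIntegral_eq_integral_of_support_subset_Ioo] at h1
  · linarith
  · exact (Function.support_mul_subset_left _ _).trans ((support_deriv_subset).trans hz)
  · exact (Function.support_mul_subset_left _ _).trans ((subset_tsupport _).trans hz)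

/-- A smooth compactly supported function with integral zero has a smooth compactly supported
primitive. -/
theorem exists_primitive_hasCompactSupport {k : ℝ → ℝ} (hk : ContDiff ℝ ∞ k)
    (hc : HasCompactSupport k) (h0 : ∫ x, k x = 0) :
    ∃ ζ : ℝ → ℝ, ContDiff ℝ ∞ ζ ∧ HasCompactSupport ζ ∧ deriv ζ = k := by
  obtain ⟨R, hR, hz⟩ := exists_tsupport_subset_Ioo hc
  have hi : ∀ a b, IntervalIntegrable k volume a b := fun a b => hk.continuous.intervalIntegrable _ _
  have hd : ∀ x, HasDerivAt (fun x => ∫ t in (-R)..x, k t) (k x) x := fun x =>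
    intervalIntegral.integral_hasDerivAt_right (hi _ _)
      hk.continuous.stronglyMeasurable.stronglyMeasurableAtFilter hk.continuous.continuousAt
  have hderiv : deriv (fun x => ∫ t in (-R)..x, k t) = k := funext fun x => (hd x).deriv
  refine ⟨fun x => ∫ t in (-R)..x, k t, ?_, ?_, hderiv⟩
  · rw [contDiff_infty_iff_deriv, hderiv]
    exact ⟨fun x => (hd x).differentiableAt, hk⟩
  · have hk0 : ∀ x, x ∉ Set.Ioo (-R) R → k x = 0 := fun x hx =>
      image_eq_zero_of_notMem_tsupport fun h => hx (hz h)
    refine HasCompactSupport.intro (isCompact_Icc (a := -R) (b := R)) fun x hx => ?_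
    rcases lt_or_ge x (-R) with h | h
    · rw [intervalIntegral.integral_congr (g := fun _ => 0)]
      · simp
      · intro t ht
        rw [Set.uIcc_of_ge h.le] at ht
        exact hk0 t fun h' => (h'.1.trans_le ht.2).false
    · have hx' : R < x := by
        by_contra! h'
        exact hx ⟨h, h'⟩
      rw [← intervalIntegral.integral_add_adjacent_intervals (hi (-R) R) (hi R x),
        intervalIntegral_eq_integral_of_support_subset_Ioo ((subset_tsupport _).trans hz), h0,
        zero_add, intervalIntegral.integral_congr (g := fun _ => 0)]
      · simp
      · intro t ht
        rw [Set.uIcc_of_le hx'.le] at ht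
        exact hk0 t fun h' => (h'.2.trans_le ht.1).false

/-- A locally integrable function whose weak derivative vanishes is constant. -/
theorem ae_eq_const_of_integral_deriv_mul_eq_zero {u : ℝ → ℝ} (hu : LocallyIntegrable u)
    (h : ∀ η : ℝ → ℝ, ContDiff ℝ ∞ η → HasCompactSupport η → ∫ x, deriv η x * u x = 0) :
    ∃ c, ∀ᵐ x, u x = c := by
  let b : ContDiffBump (0 : ℝ) := ⟨1, 2, one_pos, one_lt_two⟩
  set η₀ : ℝ → ℝ := b.normed volume with hη₀
  have hs : ContDiff ℝ ∞ η₀ := b.contDiff_normed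
  have hc : HasCompactSupport η₀ := b.hasCompactSupport_normed
  have h1 : ∫ x, η₀ x = 1 := b.integral_normed
  have hint : ∀ η : ℝ → ℝ, ContDiff ℝ ∞ η → HasCompactSupport η →
      Integrable (fun x => η x * u x) := fun η hη hηc =>
    hu.integrable_smul_left_of_hasCompactSupport hη.continuous hηc
  refine ⟨∫ x, η₀ x * u x, ae_eq_of_integral_contDiff_smul_eq hu (locallyIntegrable_const _) ?_⟩
  intro η hη hηc
  set m := ∫ x, η x with hm
  have hi := hη.continuous.integrable_of_hasCompactSupport hηc (μ := volume)
  have hi₀ := hs.continuous.integrable_of_hasCompactSupport hc (μ := volume)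
  -- Subtracting a multiple of a fixed bump of mass one makes the integral zero, so the result is
  -- the derivative of a test function.
  obtain ⟨ζ, hζ, hζc, hζd⟩ := exists_primitive_hasCompactSupport (k := fun x => η x - m * η₀ x)
    (hη.sub (contDiff_const.mul hs)) (hηc.sub (hc.mul_left (f := fun _ => m)))
    (by rw [integral_sub hi (hi₀.const_mul m), integral_const_mul, h1, hm]; ring)
  have h2 := h ζ hζ hζc
  rw [hζd] at h2
  have h3 : ∀ x, (η x - m * η₀ x) * u x = η x * u x - m * (η₀ x * u x) := fun x => by ring
  simp_rw [h3] at h2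
  rw [integral_sub (hint η hη hηc) ((hint η₀ hs hc).const_mul m), integral_const_mul] at h2
  simp only [smul_eq_mul]
  rw [integral_mul_const]
  linarith

theorem HasWeakDeriv.exists_ae_eq {f h : ℝ → ℝ} (H : HasWeakDeriv f h) :
    ∃ c, ∀ᵐ x, f x = c + ∫ t in (0 : ℝ)..x, h t := by
  obtain ⟨hf, hh, hw⟩ := H
  have hcont : Continuous fun x => ∫ t in (0 : ℝ)..x, h t :=
    intervalIntegral.continuous_primitive (intervalIntegrable_of_locallyIntegrable hh) 0
  obtain ⟨c, hc⟩ := ae_eq_const_of_integral_deriv_mul_eq_zero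
    (u := fun x => f x - ∫ t in (0 : ℝ)..x, h t) (hf.sub hcont.locallyIntegrable) (by
      intro η hη hηc
      have hd : Continuous (deriv η) := hη.continuous_deriv (by simp)
      have i1 : Integrable fun x => deriv η x * f x :=
        hf.integrable_smul_left_of_hasCompactSupport hd hηc.deriv
      have i2 : Integrable fun x => deriv η x * ∫ t in (0 : ℝ)..x, h t :=
        hcont.locallyIntegrable.integrable_smul_left_of_hasCompactSupport hd hηc.deriv
      simp_rw [mul_sub]
      rw [integral_sub i1 i2, integral_deriv_mul_primitive hh hη hηc, hw η hη hηc]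
      ring)
  exact ⟨c, hc.mono fun x hx => by linarith⟩

end BernoulliGauss

end

/-! ### Monotone transport and the Gaussian inequality on a bounded interval. -/

noncomputable section

namespace BernoulliGauss

open Filter Topology

/-- The density of the standard Gaussian measure. -/
def phi (x : ℝ) : ℝ := gaussianPDFReal 0 1 x

theorem phi_eq (x : ℝ) : phi x = (√(2 * Real.pi))⁻¹ * Real.exp (-x ^ 2 / 2) := by
  simp [phi, gaussianPDFReal]

theorem phi_pos (x : ℝ) : 0 < phi x := gaussianPDFReal_pos 0 1 x one_ne_zero

theorem phi_le (x : ℝ) : phi x ≤ phi 0 := by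
  rw [phi_eq, phi_eq]
  gcongr _ * Real.exp ?_
  nlinarith [sq_nonneg x]

theorem hasDerivAt_phi (x : ℝ) : HasDerivAt phi (-x * phi x) x := by
  have h1 : HasDerivAt (fun x : ℝ => (√(2 * Real.pi))⁻¹ * Real.exp (-x ^ 2 / 2))
      ((√(2 * Real.pi))⁻¹ * (Real.exp (-x ^ 2 / 2) * (-(2 * x) / 2))) x := by
    have h2 : HasDerivAt (fun x : ℝ => -x ^ 2 / 2) (-(2 * x) / 2) x := by
      simpa using ((hasDerivAt_pow 2 x).neg).div_const 2
    exact h2.exp.const_mul _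
  have h3 : phi = fun x : ℝ => (√(2 * Real.pi))⁻¹ * Real.exp (-x ^ 2 / 2) := funext phi_eq
  rw [phi_eq x, h3]
  convert! h1 using 1
  ring

theorem contDiff_phi : ContDiff ℝ ∞ phi := by
  have h3 : phi = fun x : ℝ => (√(2 * Real.pi))⁻¹ * Real.exp (-x ^ 2 / 2) := funext phi_eq
  rw [h3]
  fun_prop

theorem continuous_phi : Continuous phi := contDiff_phi.continuous

theorem integrable_phi : Integrable phi := integrable_gaussianPDFReal 0 1

theorem integral_phi : ∫ x, phi x = 1 := integral_gaussianPDFReal_eq_one 0 one_ne_zero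

theorem integral_gauss (f : ℝ → ℝ) : ∫ x, f x ∂gauss = ∫ x, f x * phi x := by
  rw [gauss, integral_gaussianReal_eq_integral_smul one_ne_zero]
  simp only [smul_eq_mul, mul_comm]
  rfl

theorem integrable_gauss_iff {f : ℝ → ℝ} :
    Integrable f gauss ↔ Integrable fun x => f x * phi x := by
  rw [gauss, gaussianReal_of_var_ne_zero _ one_ne_zero, integrable_withDensity_iff
    (measurable_gaussianPDF _ _) (ae_of_all _ fun _ => gaussianPDF_lt_top)]
  simp only [toReal_gaussianPDF]
  rfl

instance : IsProbabilityMeasure gauss := by unfold gauss; infer_instance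

theorem gauss_absolutelyContinuous : gauss ≪ volume :=
  gaussianReal_absolutelyContinuous 0 one_ne_zero

theorem volume_absolutelyContinuous_gauss : (volume : Measure ℝ) ≪ gauss :=
  gaussianReal_absolutelyContinuous' 0 one_ne_zero

/-- The distribution function of the measure with density `w` with respect to Lebesgue measure. -/
def distribFun (w : ℝ → ℝ) (x : ℝ) : ℝ := ∫ t in Set.Iic x, w t

section

variable {w : ℝ → ℝ} (hw : Integrable w)
include hw

theorem distribFun_sub (x y : ℝ) : distribFun w y - distribFun w x = ∫ t in x..y, w t :=
  intervalIntegral.integral_Iic_sub_Iic hw.integrableOn hw.integrableOn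

theorem continuous_distribFun : Continuous (distribFun w) := by
  have h : distribFun w = fun x => distribFun w 0 + ∫ t in (0 : ℝ)..x, w t := by
    funext x; rw [← distribFun_sub hw 0 x]; ring
  rw [h]
  exact continuous_const.add (intervalIntegral.continuous_primitive (fun _ _ => hw.intervalIntegrable) 0)

theorem tendsto_distribFun_atTop : Tendsto (distribFun w) atTop (𝓝 (∫ x, w x)) := by
  have := AECover.integral_tendsto_of_countably_generated (φ := fun x : ℝ => Set.Iic x)
    (l := atTop) (μ := volume) (aecover_Iic tendsto_id) hw
  exact this

theorem tendsto_distribFun_atBot : Tendsto (distribFun w) atBot (𝓝 0) := by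
  have h1 := AECover.integral_tendsto_of_countably_generated (φ := fun x : ℝ => Set.Ioi x)
    (l := atBot) (μ := volume) (aecover_Ioi tendsto_id) hw
  have h2 : ∀ x, distribFun w x = (∫ t, w t) - ∫ t in Set.Ioi x, w t := fun x => by
    rw [distribFun, ← intervalIntegral.integral_Iic_add_Ioi hw.integrableOn hw.integrableOn (b := x)]
    ring
  have h3 := h1.const_sub (∫ t, w t)
  rw [sub_self] at h3
  exact h3.congr fun x => (h2 x).symm

theorem strictMono_distribFun (hpos : ∀ x, 0 < w x) : StrictMono (distribFun w) := by
  intro x y hxy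
  have := intervalIntegral.intervalIntegral_pos_of_pos (hw.intervalIntegrable (a := x) (b := y))
    hpos hxy
  rw [← distribFun_sub hw] at this
  linarith

theorem distribFun_mem_Ioo (hpos : ∀ x, 0 < w x) (x : ℝ) :
    distribFun w x ∈ Set.Ioo 0 (∫ x, w x) := by
  have hm := strictMono_distribFun hw hpos
  constructor
  · have := hm.monotone.le_of_tendsto (tendsto_distribFun_atBot hw) (x - 1)
    exact this.trans_lt (hm (by linarith))
  · have := hm.monotone.ge_of_tendsto (tendsto_distribFun_atTop hw) (x + 1)
    exact lt_of_lt_of_le (hm (by linarith)) this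

theorem ae_hasDerivAt_distribFun : ∀ᵐ x, HasDerivAt (distribFun w) (w x) x := by
  filter_upwards [LocallyIntegrable.ae_hasDerivAt_integral hw.locallyIntegrable] with x hx
  have h : distribFun w = fun x => distribFun w 0 + ∫ t in (0 : ℝ)..x, w t := by
    funext x; rw [← distribFun_sub hw 0 x]; ring
  rw [h]
  exact (hx 0).const_add _

end

theorem hasDerivAt_distribFun_phi (x : ℝ) : HasDerivAt (distribFun phi) (phi x) x := by
  have h : distribFun phi = fun x => distribFun phi 0 + ∫ t in (0 : ℝ)..x, phi t := by
    funext x; rw [← distribFun_sub integrable_phi 0 x]; ring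
  rw [h]
  exact (continuous_phi.integral_hasStrictDerivAt 0 x).hasDerivAt.const_add _

/-- The monotone transport of a measure with bounded density to the standard Gaussian measure. -/
theorem exists_transport {v : ℝ → ℝ} (hv : Integrable v) (hpos : ∀ x, 0 < v x)
    (h1 : ∫ x, v x = 1) {b : ℝ} (hb : ∀ x, v x ≤ b) :
    ∃ T : ℝ → ℝ, (∀ R, 0 < R → AbsolutelyContinuousOnInterval T (-R) R) ∧
      ∀ᵐ x, DifferentiableAt ℝ T x → phi (T x) * deriv T x = v x := by
  -- `T` is the Gaussian quantile function composed with the distribution function of `v`.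
  have hex : ∀ x, ∃ y, distribFun phi y = distribFun v x := by
    intro x
    have h2 := distribFun_mem_Ioo hv hpos x
    rw [h1] at h2
    have := mem_range_of_exists_le_of_exists_ge (continuous_distribFun integrable_phi)
      (((tendsto_distribFun_atBot integrable_phi).eventually (Iio_mem_nhds h2.1)).exists.imp
        fun _ h => le_of_lt h)
      (((tendsto_distribFun_atTop integrable_phi).eventually
        (Ioi_mem_nhds (by rw [integral_phi]; exact h2.2))).exists.imp fun _ h => le_of_lt h)
    exact this
  choose T hT using hex
  have hΦ := strictMono_distribFun integrable_phi phi_pos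
  have hmono : Monotone T := fun x y hxy => by
    rw [← hΦ.le_iff_le, hT, hT]
    exact (strictMono_distribFun hv hpos).monotone hxy
  refine ⟨T, fun R hR => ?_, ?_⟩
  · obtain ⟨y₀, -, hy₀⟩ := (isCompact_Icc (a := T (-R)) (b := T R)).exists_isMinOn
      ⟨T (-R), le_rfl, hmono (by linarith)⟩ continuous_phi.continuousOn
    have hm := phi_pos y₀
    have hb0 : 0 < b := (hpos 0).trans_le (hb 0)
    apply LipschitzOnWith.absolutelyContinuousOnInterval (K := ⟨b / phi y₀, by positivity⟩)
    rw [Set.uIcc_of_le (by linarith)]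
    apply LipschitzOnWith.of_dist_le_mul
    -- The mass of `v` on `[x, y]` is at most `b * (y - x)` and equals the Gaussian mass of `[T x, T
    -- y]`, where the density is at least `phi y₀`.
    have key : ∀ x ∈ Set.Icc (-R) R, ∀ y ∈ Set.Icc (-R) R, x ≤ y →
        T y - T x ≤ b / phi y₀ * (y - x) := by
      intro x hx y hy hxy
      have h3 : distribFun v y - distribFun v x ≤ b * (y - x) := by
        rw [distribFun_sub hv]
        calc _ ≤ ∫ _ in x..y, b := intervalIntegral.integral_mono_on hxy hv.intervalIntegrable
              intervalIntegrable_const fun t _ => hb t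
          _ = _ := by simp [mul_comm]
      have h4 : phi y₀ * (T y - T x) ≤ distribFun phi (T y) - distribFun phi (T x) := by
        rw [distribFun_sub integrable_phi]
        calc _ = ∫ _ in (T x)..(T y), phi y₀ := by simp [mul_comm]
          _ ≤ _ := intervalIntegral.integral_mono_on (hmono hxy) intervalIntegrable_const
            integrable_phi.intervalIntegrable fun t ht =>
              hy₀ ⟨(hmono hx.1).trans ht.1, ht.2.trans (hmono hy.2)⟩
      rw [hT, hT] at h4
      rw [div_mul_eq_mul_div, le_div_iff₀ hm]
      linarith
    intro x hx y hy
    rcases le_total x y with hxy | hxy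
    · rw [dist_comm, dist_comm x, Real.dist_eq, Real.dist_eq,
        abs_of_nonneg (sub_nonneg.2 (hmono hxy)), abs_of_nonneg (sub_nonneg.2 hxy)]
      exact key x hx y hy hxy
    · rw [Real.dist_eq, Real.dist_eq,
        abs_of_nonneg (sub_nonneg.2 (hmono hxy)), abs_of_nonneg (sub_nonneg.2 hxy)]
      exact key y hy x hx hxy
  · filter_upwards [ae_hasDerivAt_distribFun hv] with x hx hd
    have h2 : HasDerivAt (fun x => distribFun phi (T x)) (phi (T x) * deriv T x) x :=
      (hasDerivAt_distribFun_phi (T x)).comp x hd.hasDerivAt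
    simp_rw [hT] at h2
    exact h2.unique hx

/-- The logarithmic Sobolev inequality of the Gaussian measure for absolutely continuous functions
on a bounded interval that vanish at the end points, in the dual formulation. -/
theorem integral_sq_mul_log_le {w : ℝ → ℝ} (hw : Measurable w) {a b : ℝ} (ha : 0 < a)
    (hab : ∀ x, w x ∈ Set.Icc a b) (h1 : ∫ x, w x * phi x = 1) {R : ℝ} (hR : 0 < R) {g : ℝ → ℝ}
    (hg : AbsolutelyContinuousOnInterval g (-R) R) (hg1 : g (-R) = 0) (hg2 : g R = 0)
    (hi : IntervalIntegrable (fun x => deriv g x ^ 2 * phi x) volume (-R) R) :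
    ∫ x in (-R)..R, g x ^ 2 * Real.log (w x) * phi x
      ≤ 2 * ∫ x in (-R)..R, deriv g x ^ 2 * phi x := by
  have hw0 : ∀ x, 0 < w x := fun x => ha.trans_le (hab x).1
  have hv : Integrable fun x => w x * phi x :=
    integrable_phi.bdd_mul (c := b) hw.aestronglyMeasurable
      (ae_of_all _ fun x => by rw [Real.norm_eq_abs, abs_of_pos (hw0 x)]; exact (hab x).2)
  have hb0 : 0 < b := (hw0 0).trans_le (hab 0).2
  obtain ⟨T, hTac, hTd⟩ := exists_transport hv (fun x => mul_pos (hw0 x) (phi_pos x)) h1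
    (b := b * phi 0) fun x => mul_le_mul (hab x).2 (phi_le x) (phi_pos x).le hb0.le
  have hT := hTac R hR
  have hid : AbsolutelyContinuousOnInterval (fun x : ℝ => x) (-R) R :=
    contDiff_id.contDiffOn.absolutelyContinuousOnInterval
  have hphi : AbsolutelyContinuousOnInterval phi (-R) R :=
    (contDiff_phi.of_le (by exact_mod_cast le_top)).contDiffOn.absolutelyContinuousOnInterval
  have hF : AbsolutelyContinuousOnInterval (fun x => (T x - x) * phi x) (-R) R :=
    (hT.fun_sub hid).fun_mul hphi
  have hgg : AbsolutelyContinuousOnInterval (fun x => g x * g x) (-R) R := hg.fun_mul hg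
  have hibp := hgg.integral_deriv_mul_eq_sub hF
  have hle : -R ≤ R := by linarith
  have i1 : IntervalIntegrable (fun x => deriv (fun x => g x * g x) x * ((T x - x) * phi x)
      + g x * g x * deriv (fun x => (T x - x) * phi x) x) volume (-R) R :=
    (hgg.intervalIntegrable_deriv.mul_continuousOn hF.continuousOn).add
      (hF.intervalIntegrable_deriv.continuousOn_mul hgg.continuousOn)
  have i2 : IntervalIntegrable (fun x => g x ^ 2 * Real.log (w x) * phi x) volume (-R) R := by
    have hc : IntervalIntegrable (fun x => g x ^ 2 * phi x) volume (-R) R :=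
      ((hg.continuousOn.pow 2).mul continuous_phi.continuousOn).intervalIntegrable
    rw [intervalIntegrable_iff] at hc ⊢
    have := hc.mul_bdd (c := max |Real.log a| |Real.log b|)
      (Real.measurable_log.comp hw).aestronglyMeasurable (ae_of_all _ fun x =>
        abs_le_max_abs_abs (Real.log_le_log ha (hab x).1) (Real.log_le_log (hw0 x) (hab x).2))
    refine this.congr (ae_of_all _ fun x => ?_)
    simp only [Function.comp]
    ring
  -- The first two terms form the derivative of `g² (T - x) phi`, which integrates to zero since `g`
  -- vanishes at the end points.
  calc _ ≤ ∫ x in (-R)..R, ((deriv (fun x => g x * g x) x * ((T x - x) * phi x)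
      + g x * g x * deriv (fun x => (T x - x) * phi x) x) + 2 * (deriv g x ^ 2 * phi x)) := by
        apply intervalIntegral.integral_mono_ae_restrict hle i2 (i1.add (hi.const_mul 2))
        rw [EventuallyLE, ae_restrict_iff' measurableSet_Icc]
        filter_upwards [hTd, hT.ae_differentiableAt, hg.ae_differentiableAt] with x h2 h3 h4 hx
        rw [Set.uIcc_of_le hle] at h3 h4
        have hTx := (h3 hx).hasDerivAt
        have hgx := (h4 hx).hasDerivAt
        have h5 := h2 (h3 hx)
        have e1 : deriv (fun x => g x * g x) x = 2 * (g x * deriv g x) :=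
          (hgx.mul hgx).deriv.trans (by ring)
        have e2 : deriv (fun x => (T x - x) * phi x) x
            = (deriv T x - 1) * phi x + (T x - x) * (-x * phi x) :=
          ((hTx.sub (hasDerivAt_id x)).mul (hasDerivAt_phi x)).deriv
        rw [e1, e2]
        have hD : 0 < deriv T x := by
          have : 0 < phi (T x) * deriv T x := by
            rw [h5]; exact mul_pos (hw0 x) (phi_pos x)
          exact pos_of_mul_pos_right this (phi_pos _).le
        -- Logarithm of the transport equation `phi (T x) * T' = w * phi x`, with `log T' ≤ T' - 1`.
        have hlog : Real.log (w x) ≤ (x ^ 2 - T x ^ 2) / 2 + (deriv T x - 1) := by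
          have e3 : Real.log (w x) = Real.log (phi (T x)) + Real.log (deriv T x)
              - Real.log (phi x) := by
            rw [← Real.log_mul (phi_pos _).ne' hD.ne', h5, Real.log_mul (hw0 x).ne' (phi_pos x).ne']
            ring
          have hpi : (√(2 * Real.pi))⁻¹ ≠ 0 := by positivity
          have e4 : ∀ y, Real.log (phi y) = Real.log (√(2 * Real.pi))⁻¹ + -y ^ 2 / 2 := fun y => by
            rw [phi_eq, Real.log_mul hpi (Real.exp_pos _).ne', Real.log_exp]
          have := Real.log_le_sub_one_of_pos hD
          rw [e3, e4, e4]
          linarith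
        have h6 := mul_le_mul_of_nonneg_left hlog (mul_nonneg (sq_nonneg (g x)) (phi_pos x).le)
        -- Since `(x² - T²) / 2 = -x (T - x) - (T - x)² / 2`, what remains after the exact
        -- derivative is this square.
        have h7 : 0 ≤ 2 * (deriv g x + g x * (T x - x) / 2) ^ 2 * phi x :=
          mul_nonneg (by positivity) (phi_pos x).le
        nlinarith
    _ = _ := by
      rw [intervalIntegral.integral_add i1 (hi.const_mul 2), hibp,
        intervalIntegral.integral_const_mul, hg1, hg2]
      ring

end BernoulliGauss

end

/-! ### The Gaussian inequality on the whole line, by cut-off. -/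

noncomputable section

namespace BernoulliGauss

open Filter Topology

/-- The cut-off inequality on `[-R, R]`. -/
theorem integral_sq_cutoff_mul_log_le {w : ℝ → ℝ} (hw : Measurable w) {a b : ℝ} (ha : 0 < a)
    (hab : ∀ x, w x ∈ Set.Icc a b) (h1 : ∫ x, w x * phi x = 1) {R : ℝ} (hR : 0 < R) {h : ℝ → ℝ}
    (hh : LocallyIntegrable h) (hh2 : MemLp h 2 gauss) (c : ℝ) {G : ℝ → ℝ}
    (hG : ∀ x, G x = c + ∫ t in (0 : ℝ)..x, h t) :
    ∫ x in (-R)..R, ((1 - x ^ 2 / R ^ 2) * G x) ^ 2 * Real.log (w x) * phi x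
      ≤ 2 * ∫ x in (-R)..R, ((1 - x ^ 2 / R ^ 2) * h x - 2 * x / R ^ 2 * G x) ^ 2 * phi x := by
  have hle : -R ≤ R := by linarith
  have hGf : G = fun x => c + ∫ t in (0 : ℝ)..x, h t := funext hG
  have hcont : Continuous G := by
    rw [hGf]
    exact continuous_const.add
      (intervalIntegral.continuous_primitive (intervalIntegrable_of_locallyIntegrable hh) 0)
  have hGac : AbsolutelyContinuousOnInterval G (-R) R := by
    rw [hGf]
    refine AbsolutelyContinuousOnInterval.fun_add
      (contDiff_const.contDiffOn.absolutelyContinuousOnInterval) ?_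
    refine (intervalIntegrable_of_locallyIntegrable hh _ _).absolutelyContinuousOnInterval_intervalIntegral ?_
    rw [Set.uIcc_of_le hle]; exact ⟨by linarith, hR.le⟩
  have hχ : AbsolutelyContinuousOnInterval (fun x : ℝ => 1 - x ^ 2 / R ^ 2) (-R) R :=
    ContDiffOn.absolutelyContinuousOnInterval (ContDiff.contDiffOn (by fun_prop))
  have hg : AbsolutelyContinuousOnInterval (fun x => (1 - x ^ 2 / R ^ 2) * G x) (-R) R :=
    hχ.fun_mul hGac
  have hd : ∀ᵐ x, deriv (fun x => (1 - x ^ 2 / R ^ 2) * G x) x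
      = (1 - x ^ 2 / R ^ 2) * h x - 2 * x / R ^ 2 * G x := by
    filter_upwards [LocallyIntegrable.ae_hasDerivAt_integral hh] with x hx
    have e1 : HasDerivAt G (h x) x := by
      rw [hGf]; exact (hx 0).const_add c
    have e2 : HasDerivAt (fun x : ℝ => 1 - x ^ 2 / R ^ 2) (-(2 * x / R ^ 2)) x := by
      simpa using ((hasDerivAt_pow 2 x).div_const (R ^ 2)).const_sub 1
    exact (e2.mul e1).deriv.trans (by ring)
  have hd' : ∀ᵐ x, deriv (fun x => (1 - x ^ 2 / R ^ 2) * G x) x ^ 2 * phi x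
      = ((1 - x ^ 2 / R ^ 2) * h x - 2 * x / R ^ 2 * G x) ^ 2 * phi x :=
    hd.mono fun x hx => by rw [hx]
  have hi : IntervalIntegrable
      (fun x => ((1 - x ^ 2 / R ^ 2) * h x - 2 * x / R ^ 2 * G x) ^ 2 * phi x) volume (-R) R := by
    have i0 : IntervalIntegrable (fun x => h x ^ 2 * phi x) volume (-R) R :=
      (integrable_gauss_iff.1 hh2.integrable_sq).intervalIntegrable
    have ih := intervalIntegrable_of_locallyIntegrable hh (-R) R
    have i1 := i0.continuousOn_mul (g := fun x => (1 - x ^ 2 / R ^ 2) ^ 2)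
      (Continuous.continuousOn (by fun_prop))
    have i2 := ih.continuousOn_mul
      (g := fun x => -2 * ((1 - x ^ 2 / R ^ 2) * (2 * x / R ^ 2 * G x)) * phi x)
      (Continuous.continuousOn (by have := continuous_phi; fun_prop))
    have i3 : IntervalIntegrable (fun x => (2 * x / R ^ 2 * G x) ^ 2 * phi x) volume (-R) R :=
      Continuous.intervalIntegrable (by have := continuous_phi; fun_prop) _ _
    -- The square is expanded: the term in `h²` is integrable because `h ∈ L²(gauss)`, the cross
    -- term because `h` is locally integrable, and the last one is continuous.
    refine IntervalIntegrable.congr (fun x _ => ?_) ((i1.add i2).add i3)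
    ring
  have key := integral_sq_mul_log_le hw ha hab h1 hR hg (by simp [hR.ne']) (by simp [hR.ne'])
    (hi.congr_ae (ae_restrict_of_ae (hd'.mono fun x hx => hx.symm)))
  rwa [intervalIntegral.integral_congr_ae (hd'.mono fun x hx _ => hx)] at key

/-- The Gaussian logarithmic Sobolev inequality for weakly differentiable functions, in the dual
formulation. -/
theorem entBound_gauss {f h : ℝ → ℝ} (hf : MemLp f 2 gauss) (hh : MemLp h 2 gauss)
    (H : HasWeakDeriv f h) : EntBound gauss f (2 * ∫ x, h x ^ 2 ∂gauss) := by
  rintro ψ hψ ⟨C, hC⟩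
  obtain ⟨c, hc⟩ := H.exists_ae_eq
  set G : ℝ → ℝ := fun x => c + ∫ t in (0 : ℝ)..x, h t with hG
  have hfG : f =ᵐ[gauss] G := gauss_absolutelyContinuous.ae_eq hc
  have hG2 : MemLp G 2 gauss := (memLp_congr_ae hfG).1 hf
  have e1 : ∫ x, f x ^ 2 * ψ x ∂gauss = ∫ x, G x ^ 2 * ψ x ∂gauss :=
    integral_congr_ae (hfG.mono fun x hx => by simp only [hx])
  have e2 : ∫ x, f x ^ 2 ∂gauss = ∫ x, G x ^ 2 ∂gauss :=
    integral_congr_ae (hfG.mono fun x hx => by simp only [hx])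
  rw [e1, e2]
  have hexp : Integrable (fun x => Real.exp (ψ x)) gauss :=
    Integrable.of_bound (Real.measurable_exp.comp hψ).aestronglyMeasurable (Real.exp C)
      (ae_of_all _ fun x => by
        rw [Real.norm_eq_abs, Real.abs_exp]; exact Real.exp_le_exp.2 (abs_le.1 (hC x)).2)
  set m := ∫ x, Real.exp (ψ x) ∂gauss with hm
  have hm0 : 0 < m := integral_exp_pos hexp
  -- Normalized to be a probability density with respect to `gauss`, bounded away from `0` and `∞`.
  set w : ℝ → ℝ := fun x => Real.exp (ψ x - Real.log m) with hw
  have hlw : ∀ x, Real.log (w x) = ψ x - Real.log m := fun x => Real.log_exp _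
  have hwm : Measurable w := Real.measurable_exp.comp (hψ.sub_const _)
  have hab : ∀ x, w x ∈ Set.Icc (Real.exp (-C - Real.log m)) (Real.exp (C - Real.log m)) :=
    fun x => ⟨Real.exp_le_exp.2 (by linarith [(abs_le.1 (hC x)).1]),
      Real.exp_le_exp.2 (by linarith [(abs_le.1 (hC x)).2])⟩
  have hw1 : ∫ x, w x * phi x = 1 := by
    rw [← integral_gauss]
    simp only [hw, Real.exp_sub, Real.exp_log hm0]
    rw [integral_div, ← hm, div_self hm0.ne']
  have hB : ∀ x, |Real.log (w x)| ≤ C + |Real.log m| := fun x => by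
    rw [hlw]; exact (abs_sub _ _).trans (by linarith [hC x])
  -- The cut-off at `R = n + 1`, so that `R ≥ 1`; `χ'` is minus its derivative, bounded by `2` on `J
  -- n` and tending to `0`.
  set χ : ℕ → ℝ → ℝ := fun n x => 1 - x ^ 2 / ((n : ℝ) + 1) ^ 2 with hχ
  set χ' : ℕ → ℝ → ℝ := fun n x => 2 * x / ((n : ℝ) + 1) ^ 2 with hχ'
  set J : ℕ → Set ℝ := fun n => Set.Ioc (-((n : ℝ) + 1)) ((n : ℝ) + 1) with hJ
  have hχ1 : ∀ n, ∀ x ∈ J n, |χ n x| ≤ 1 := by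
    intro n x hx
    have hn : (0 : ℝ) < (n : ℝ) + 1 := by positivity
    have h1 : x ^ 2 ≤ ((n : ℝ) + 1) ^ 2 := sq_le_sq' (by linarith [hx.1]) hx.2
    have h2 : x ^ 2 / ((n : ℝ) + 1) ^ 2 ≤ 1 := div_le_one_of_le₀ h1 (by positivity)
    have h3 : 0 ≤ x ^ 2 / ((n : ℝ) + 1) ^ 2 := by positivity
    rw [abs_le]
    constructor <;> simp only [hχ] <;> linarith
  have hχ2 : ∀ n, ∀ x ∈ J n, |χ' n x| ≤ 2 := by
    intro n x hx
    have hn : (1 : ℝ) ≤ (n : ℝ) + 1 := by simp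
    have h1 : |x| ≤ (n : ℝ) + 1 := abs_le.2 ⟨hx.1.le, hx.2⟩
    simp only [hχ', abs_div, abs_mul, abs_two, abs_of_nonneg (sq_nonneg ((n : ℝ) + 1))]
    rw [div_le_iff₀ (by positivity)]
    nlinarith
  have hlimχ : ∀ x, Tendsto (fun n => χ n x) atTop (𝓝 1) := by
    intro x
    have h1 : Tendsto (fun n : ℕ => ((n : ℝ) + 1) ^ 2) atTop atTop :=
      (tendsto_pow_atTop two_ne_zero).comp (tendsto_natCast_atTop_atTop.atTop_add tendsto_const_nhds)
    simpa using (h1.const_div_atTop (x ^ 2)).const_sub 1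
  have hlimχ' : ∀ x, Tendsto (fun n => χ' n x) atTop (𝓝 0) := by
    intro x
    have h1 : Tendsto (fun n : ℕ => ((n : ℝ) + 1) ^ 2) atTop atTop :=
      (tendsto_pow_atTop two_ne_zero).comp (tendsto_natCast_atTop_atTop.atTop_add tendsto_const_nhds)
    exact h1.const_div_atTop (2 * x)
  have hev : ∀ x, ∀ᶠ n : ℕ in atTop, x ∈ J n := by
    intro x
    filter_upwards [eventually_ge_atTop ⌈|x|⌉₊] with n hn
    have h1 : |x| ≤ n := (Nat.le_ceil _).trans (by exact_mod_cast hn)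
    have h2 := abs_le.1 h1
    exact ⟨by linarith, by linarith⟩
  have conv : ∀ (F : ℕ → ℝ → ℝ) (n : ℕ), ∫ x in (-((n : ℝ) + 1))..((n : ℝ) + 1), F n x * phi x
      = ∫ x, (J n).indicator (F n) x ∂gauss := by
    intro F n
    rw [intervalIntegral.integral_of_le (by linarith [show (0 : ℝ) ≤ n by positivity]),
      ← integral_indicator measurableSet_Ioc, integral_gauss]
    congr 1 with x
    simp only [Set.indicator_apply]
    split_ifs <;> simp
  have hind : ∀ (F : ℕ → ℝ → ℝ) (l : ℝ) (x : ℝ), Tendsto (fun n => F n x) atTop (𝓝 l) →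
      Tendsto (fun n => (J n).indicator (F n) x) atTop (𝓝 l) := by
    intro F l x hl
    refine hl.congr' ?_
    filter_upwards [hev x] with n hn
    rw [Set.indicator_of_mem hn]
  have hχm : ∀ n, Measurable (χ n) := fun n => by simp only [hχ]; fun_prop
  have hχm' : ∀ n, Measurable (χ' n) := fun n => by simp only [hχ']; fun_prop
  have lim1 : Tendsto (fun n => ∫ x, (J n).indicator
      (fun x => (χ n x * G x) ^ 2 * Real.log (w x)) x ∂gauss) atTop
      (𝓝 (∫ x, G x ^ 2 * Real.log (w x) ∂gauss)) := by
    refine tendsto_integral_of_dominated_convergence (fun x => G x ^ 2 * (C + |Real.log m|))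
      (fun n => ?_) (hG2.integrable_sq.mul_const _) (fun n => ae_of_all _ fun x => ?_)
      (ae_of_all _ fun x => ?_)
    · exact ((((hχm n).aestronglyMeasurable.mul hG2.1).pow 2).mul
        (Real.measurable_log.comp hwm).aestronglyMeasurable).indicator measurableSet_Ioc
    · by_cases hx : x ∈ J n
      · rw [Set.indicator_of_mem hx, norm_mul, Real.norm_eq_abs, Real.norm_eq_abs, abs_sq, mul_pow]
        have h1 : χ n x ^ 2 ≤ 1 := by
          rw [← sq_abs]; exact pow_le_one₀ (abs_nonneg _) (hχ1 n x hx)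
        have h2 : χ n x ^ 2 * G x ^ 2 ≤ G x ^ 2 := mul_le_of_le_one_left (sq_nonneg _) h1
        exact mul_le_mul h2 (hB x) (abs_nonneg _) (sq_nonneg _)
      · rw [Set.indicator_of_notMem hx, norm_zero]
        exact mul_nonneg (sq_nonneg _) ((abs_nonneg _).trans (hB x))
    · refine hind (fun n x => (χ n x * G x) ^ 2 * Real.log (w x)) _ x ?_
      simpa using (((hlimχ x).mul_const (G x)).pow 2).mul_const (Real.log (w x))
  have lim2 : Tendsto (fun n => ∫ x, (J n).indicator
      (fun x => (χ n x * h x - χ' n x * G x) ^ 2) x ∂gauss) atTop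
      (𝓝 (∫ x, h x ^ 2 ∂gauss)) := by
    -- The majorant comes from `(x - y)² ≤ 2 x² + 2 y²` with `|χ| ≤ 1` and `|χ'| ≤ 2`.
    refine tendsto_integral_of_dominated_convergence (fun x => 2 * h x ^ 2 + 8 * G x ^ 2)
      (fun n => ?_) ((hh.integrable_sq.const_mul 2).add (hG2.integrable_sq.const_mul 8))
      (fun n => ae_of_all _ fun x => ?_) (ae_of_all _ fun x => ?_)
    · exact ((((hχm n).aestronglyMeasurable.mul hh.1).sub
        ((hχm' n).aestronglyMeasurable.mul hG2.1)).pow 2).indicator measurableSet_Ioc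
    · by_cases hx : x ∈ J n
      · rw [Set.indicator_of_mem hx, Real.norm_eq_abs, abs_sq]
        have h1 : χ n x ^ 2 ≤ 1 := by
          rw [← sq_abs]; exact pow_le_one₀ (abs_nonneg _) (hχ1 n x hx)
        have h2 : χ' n x ^ 2 ≤ 4 := by
          rw [← sq_abs]; nlinarith [hχ2 n x hx, abs_nonneg (χ' n x)]
        have h3 : χ n x ^ 2 * h x ^ 2 ≤ h x ^ 2 := mul_le_of_le_one_left (sq_nonneg _) h1
        have h4 : χ' n x ^ 2 * G x ^ 2 ≤ 4 * G x ^ 2 :=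
          mul_le_mul_of_nonneg_right h2 (sq_nonneg _)
        nlinarith [sq_nonneg (χ n x * h x + χ' n x * G x)]
      · rw [Set.indicator_of_notMem hx, norm_zero]
        positivity
    · refine hind (fun n x => (χ n x * h x - χ' n x * G x) ^ 2) _ x ?_
      simpa using (((hlimχ x).mul_const (h x)).sub ((hlimχ' x).mul_const (G x))).pow 2
  have hle : ∫ x, G x ^ 2 * Real.log (w x) ∂gauss ≤ 2 * ∫ x, h x ^ 2 ∂gauss := by
    refine le_of_tendsto_of_tendsto' lim1 (lim2.const_mul 2) fun n => ?_
    rw [← conv (fun n x => (χ n x * G x) ^ 2 * Real.log (w x)),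
      ← conv (fun n x => (χ n x * h x - χ' n x * G x) ^ 2)]
    exact integral_sq_cutoff_mul_log_le hwm (Real.exp_pos _) hab hw1 (by positivity) H.2.1 hh c
      fun x => rfl
  have hGψ : Integrable (fun x => G x ^ 2 * ψ x) gauss :=
    hG2.integrable_sq.mul_bdd hψ.aestronglyMeasurable (ae_of_all _ hC)
  simp_rw [hlw, mul_sub] at hle
  rw [integral_sub hGψ (hG2.integrable_sq.mul_const _), integral_mul_const] at hle
  linarith

end BernoulliGauss

end

/-! ### Stability of weak derivatives; kernels given by resampling maps. -/

noncomputable section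

namespace BernoulliGauss

theorem HasWeakDeriv.congr {f f' h h' : ℝ → ℝ} (H : HasWeakDeriv f h) (hf : f =ᵐ[volume] f')
    (hh : h =ᵐ[volume] h') : HasWeakDeriv f' h' := by
  refine ⟨H.1.congr hf, H.2.1.congr hh, fun g hg hgc => ?_⟩
  have e1 : ∫ t, g t * h' t = ∫ t, g t * h t :=
    integral_congr_ae (hh.mono fun t ht => by simp only [ht])
  have e2 : ∫ t, deriv g t * f' t = ∫ t, deriv g t * f t :=
    integral_congr_ae (hf.mono fun t ht => by simp only [ht])
  rw [e1, e2]
  exact H.2.2 g hg hgc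

theorem HasWeakDeriv.sub {f f' h h' : ℝ → ℝ} (H : HasWeakDeriv f h) (H' : HasWeakDeriv f' h') :
    HasWeakDeriv (fun t => f t - f' t) (fun t => h t - h' t) := by
  refine ⟨H.1.sub H'.1, H.2.1.sub H'.2.1, fun g hg hgc => ?_⟩
  have hd : Continuous (deriv g) := hg.continuous_deriv (by simp)
  have i1 : ∀ {u}, LocallyIntegrable u → Integrable fun t => deriv g t * u t := fun hu =>
    hu.integrable_smul_left_of_hasCompactSupport hd hgc.deriv
  have i2 : ∀ {u}, LocallyIntegrable u → Integrable fun t => g t * u t := fun hu =>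
    hu.integrable_smul_left_of_hasCompactSupport hg.continuous hgc
  simp_rw [mul_sub]
  rw [integral_sub (i2 H.2.1) (i2 H'.2.1), integral_sub (i1 H.1) (i1 H'.1), H.2.2 g hg hgc,
    H'.2.2 g hg hgc]
  ring

theorem hasWeakDeriv_const (c : ℝ) : HasWeakDeriv (fun _ => c) (fun _ => 0) := by
  refine ⟨locallyIntegrable_const _, locallyIntegrable_const _, fun g hg hgc => ?_⟩
  obtain ⟨R, hR, hz⟩ := exists_tsupport_subset_Ioo hgc
  have h1 : ∫ t, deriv g t = 0 := by
    rw [← intervalIntegral_eq_integral_of_support_subset_Ioo (support_deriv_subset.trans hz),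
      intervalIntegral.integral_deriv_eq_sub
        (fun x _ => (hg.differentiable (by simp)).differentiableAt)
        ((hg.continuous_deriv (by simp)).intervalIntegrable _ _),
      image_eq_zero_of_notMem_tsupport fun h => (hz h).2.false,
      image_eq_zero_of_notMem_tsupport fun h => (hz h).1.false, sub_zero]
  simp [integral_mul_const, h1]

/-- The reciprocal of the Gaussian density is continuous, hence bounded on compact sets. -/
theorem locallyIntegrable_of_integrable_gauss {f : ℝ → ℝ} (hf : Integrable f gauss) :
    LocallyIntegrable f := by
  rw [locallyIntegrable_iff]
  intro k hk
  have h1 := (integrable_gauss_iff.1 hf).integrableOn (s := k)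
  have h2 : ContinuousOn (fun x => (phi x)⁻¹) k :=
    (continuous_phi.inv₀ fun x => (phi_pos x).ne').continuousOn
  refine (h1.mul_continuousOn h2 hk).congr_fun (fun x _ => ?_) hk.measurableSet
  field_simp [(phi_pos x).ne']

section

variable {Ω : Type*} [MeasurableSpace Ω] {ν : Measure Ω} [IsProbabilityMeasure ν]

omit [IsProbabilityMeasure ν] in
theorem integrable_prod_gauss_iff {F : Ω × ℝ → ℝ} :
    Integrable F (ν.prod gauss) ↔ Integrable (fun z => F z * phi z.2) (ν.prod volume) := by
  have h1 : ν.prod gauss = (ν.prod volume).withDensity (fun z => gaussianPDF 0 1 z.2) := by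
    rw [gauss, gaussianReal_of_var_ne_zero _ one_ne_zero,
      prod_withDensity_right (measurable_gaussianPDF 0 1)]
  rw [h1, integrable_withDensity_iff (f := fun z : Ω × ℝ => gaussianPDF 0 1 z.2)
    ((measurable_gaussianPDF 0 1).comp measurable_snd) (ae_of_all _ fun _ => gaussianPDF_lt_top)]
  simp only [toReal_gaussianPDF]
  rfl

omit [IsProbabilityMeasure ν] in
theorem integrable_mul_of_integrable_prod_gauss {F : Ω × ℝ → ℝ} (hF : Integrable F (ν.prod gauss))
    {k : ℝ → ℝ} (hk : Continuous k) (hc : HasCompactSupport k) :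
    Integrable (fun z : Ω × ℝ => k z.2 * F z) (ν.prod volume) := by
  have hq : Continuous fun t => k t * (phi t)⁻¹ :=
    hk.mul (continuous_phi.inv₀ fun x => (phi_pos x).ne')
  obtain ⟨C, hC⟩ := hq.bounded_above_of_compact_support hc.mul_right
  refine ((integrable_prod_gauss_iff.1 hF).bdd_mul (c := C)
    (hq.measurable.comp measurable_snd).aestronglyMeasurable
    (ae_of_all _ fun z => hC z.2)).congr (ae_of_all _ fun z => ?_)
  simp only [Function.comp]
  field_simp [ne_of_gt (phi_pos z.2)]

/-- Weak derivatives commute with averaging over a parameter. -/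
theorem HasWeakDeriv.integral {F H : Ω × ℝ → ℝ} (hF : Integrable F (ν.prod gauss))
    (hH : Integrable H (ν.prod gauss))
    (h : ∀ᵐ s ∂ν, HasWeakDeriv (fun t => F (s, t)) (fun t => H (s, t))) :
    HasWeakDeriv (fun t => ∫ s, F (s, t) ∂ν) (fun t => ∫ s, H (s, t) ∂ν) := by
  refine ⟨locallyIntegrable_of_integrable_gauss hF.integral_prod_right,
    locallyIntegrable_of_integrable_gauss hH.integral_prod_right, fun g hg hgc => ?_⟩
  have hd : Continuous (deriv g) := hg.continuous_deriv (by simp)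
  have i1 := integrable_mul_of_integrable_prod_gauss hH hg.continuous hgc
  have i2 := integrable_mul_of_integrable_prod_gauss hF hd hgc.deriv
  simp_rw [← integral_const_mul]
  -- Fubini reduces the identity to the one for almost every fixed parameter `s`.
  rw [← integral_integral_swap (f := fun s t => g t * H (s, t)) i1,
    ← integral_integral_swap (f := fun s t => deriv g t * F (s, t)) i2, ← integral_neg]
  exact integral_congr_ae (h.mono fun s hs => hs.2.2 g hg hgc)

end

section Resample

variable {X Ω Ω' : Type*} [MeasurableSpace X] [MeasurableSpace Ω'] [MeasurableSpace Ω]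

/-- The kernel that replaces `z` by `U z s`, where `s` has law `ν`. -/
def resample (U : X → Ω → X) (ν : Measure Ω) [SFinite ν] (hU : Measurable (Function.uncurry U)) :
    Kernel X X where
  toFun z := ν.map (U z)
  measurable' := by
    refine Measure.measurable_of_measurable_coe _ fun A hA => ?_
    have h1 : ∀ z, (ν.map (U z)) A = ν (Prod.mk z ⁻¹' (Function.uncurry U ⁻¹' A)) := fun z => by
      rw [Measure.map_apply hU.of_uncurry_left hA]
      rfl
    simp_rw [h1]
    exact measurable_measure_prodMk_left (hU hA)

variable {U : X → Ω → X} {ν : Measure Ω} [IsProbabilityMeasure ν]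
  {hU : Measurable (Function.uncurry U)} {V : X → Ω' → X} {ν' : Measure Ω'}
  [IsProbabilityMeasure ν'] {hV : Measurable (Function.uncurry V)} {μ : Measure X}

theorem resample_apply (z : X) : resample U ν hU z = ν.map (U z) := rfl

instance : IsMarkovKernel (resample U ν hU) :=
  ⟨fun z => by
    rw [resample_apply]
    exact Measure.isProbabilityMeasure_map hU.of_uncurry_left.aemeasurable⟩

theorem integral_resample {f : X → ℝ} (hf : StronglyMeasurable f) (z : X) :
    ∫ w, f w ∂(resample U ν hU z) = ∫ s, f (U z s) ∂ν :=
  integral_map hU.of_uncurry_left.aemeasurable hf.aestronglyMeasurable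

/-- By `hUU` a second replacement overwrites the first, so averages do not change along a class. -/
theorem isResampling_resample [SFinite μ]
    (hmp : MeasurePreserving (Function.uncurry U) (μ.prod ν) μ)
    (hUU : ∀ z s t, U (U z s) t = U z t) : IsResampling (resample U ν hU) μ where
  comp_eq := by
    ext A hA
    rw [Measure.bind_apply hA (Kernel.aemeasurable _)]
    nth_rewrite 2 [← hmp.map_eq]
    rw [Measure.map_apply hU hA, Measure.prod_apply (hU hA)]
    refine lintegral_congr fun z => ?_
    rw [resample_apply, Measure.map_apply hU.of_uncurry_left hA]
    rfl
  ae_avg_eq f hf z := by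
    have hm : Measurable (avg (resample U ν hU) f) := (stronglyMeasurable_avg hf).measurable
    rw [resample_apply, ae_map_iff hU.of_uncurry_left.aemeasurable
      (measurableSet_eq_fun hm measurable_const)]
    refine ae_of_all _ fun s => ?_
    simp only [avg, integral_resample hf, hUU]

theorem resample_comp_comm (hUV : ∀ z s t, V (U z s) t = U (V z t) s) :
    resample V ν' hV ∘ₖ resample U ν hU = resample U ν hU ∘ₖ resample V ν' hV := by
  ext z A hA
  rw [Kernel.comp_apply' _ _ _ hA, Kernel.comp_apply' _ _ _ hA, resample_apply, resample_apply,
    lintegral_map (Kernel.measurable_coe _ hA) hU.of_uncurry_left,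
    lintegral_map (Kernel.measurable_coe _ hA) hV.of_uncurry_left]
  have e1 : ∀ s, (resample V ν' hV (U z s)) A = ∫⁻ t, A.indicator 1 (V (U z s) t) ∂ν' := fun s => by
    rw [resample_apply, ← lintegral_indicator_one hA, lintegral_map (measurable_one.indicator hA)
      hV.of_uncurry_left]
  have e2 : ∀ t, (resample U ν hU (V z t)) A = ∫⁻ s, A.indicator 1 (V (U z s) t) ∂ν := fun t => by
    simp_rw [hUV]
    rw [resample_apply, ← lintegral_indicator_one hA, lintegral_map (measurable_one.indicator hA)
      hU.of_uncurry_left]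
  simp_rw [e1, e2]
  rw [lintegral_lintegral_swap]
  have hm : Measurable fun p : Ω × Ω' => V (U z p.1) p.2 :=
    hV.comp ((hU.of_uncurry_left.comp measurable_fst).prodMk measurable_snd)
  exact ((measurable_one.indicator hA).comp hm).aemeasurable

end Resample

end BernoulliGauss

end

/-! ### Convergence of iterated averages: from a π-system to `L²`. -/

noncomputable section

namespace BernoulliGauss

open Filter Topology

variable {X : Type*} [MeasurableSpace X] {μ : Measure X} {K : ℕ → Kernel X X}

/-- The iterated averages of `u` converge to the mean of `u` in `L²`. -/
def MeanConv (K : ℕ → Kernel X X) (μ : Measure X) (u : X → ℝ) : Prop :=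
  Tendsto (fun n => ∫ z, (avgIter K n u z - ∫ w, u w ∂μ) ^ 2 ∂μ) atTop (𝓝 0)

theorem avgIter_const_mul (c : ℝ) (u : X → ℝ) (n : ℕ) :
    avgIter K n (fun z => c * u z) = fun z => c * avgIter K n u z := by
  induction n with
  | zero => rfl
  | succ n ih =>
    simp only [avgIter, ih]
    funext z
    exact integral_const_mul _ _

theorem MeanConv.const_mul {u : X → ℝ} (hu : MeanConv K μ u) (c : ℝ) :
    MeanConv K μ fun z => c * u z := by
  have h := Tendsto.const_mul (c ^ 2) hu
  rw [mul_zero] at h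
  refine h.congr fun n => ?_
  rw [avgIter_const_mul, integral_const_mul c u, ← integral_const_mul (c ^ 2)]
  refine integral_congr_ae (ae_of_all _ fun z => ?_)
  simp only
  ring

variable [∀ n, IsMarkovKernel (K n)]

theorem avgIter_const (c : ℝ) (n : ℕ) : avgIter K n (fun _ => c) = fun _ => c := by
  induction n with
  | zero => rfl
  | succ n ih =>
    simp only [avgIter, ih]
    funext z
    simp [avg]

variable [IsProbabilityMeasure μ]

theorem meanConv_const (c : ℝ) : MeanConv K μ fun _ => c := by
  simp [MeanConv, avgIter_const]

section

variable (hr : ∀ n, IsResampling (K n) μ)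
include hr

theorem integral_sq_avgIter_le {u : X → ℝ} (hu : MemLp u 2 μ) (n : ℕ) :
    ∫ z, avgIter K n u z ^ 2 ∂μ ≤ ∫ z, u z ^ 2 ∂μ := by
  induction n with
  | zero => rfl
  | succ n ih =>
    have h1 := (hr n).integral_sq_sub_avg (memLp_two_avgIter hr hu n)
    have h2 : 0 ≤ ∫ z, (avgIter K n u z - avg (K n) (avgIter K n u) z) ^ 2 ∂μ :=
      integral_nonneg fun z => sq_nonneg _
    refine le_trans ?_ ih
    simp only [avgIter]
    linarith

/-- Writing `u = v + (u - v)` with `(x + y)² ≤ 2 x² + 2 y²`; this yields closure of `MeanConv` under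
both sums and `L²` limits. -/
theorem integral_sq_avgIter_sub_le {u v : X → ℝ} (hu : MemLp u 2 μ) (hv : MemLp v 2 μ) (n : ℕ) :
    ∫ z, (avgIter K n u z - ∫ w, u w ∂μ) ^ 2 ∂μ
      ≤ 2 * (∫ z, (avgIter K n v z - ∫ w, v w ∂μ) ^ 2 ∂μ)
        + 2 * ∫ z, (avgIter K n (fun z => u z - v z) z - ∫ w, (u w - v w) ∂μ) ^ 2 ∂μ := by
  have hu1 := hu.integrable one_le_two
  have hv1 := hv.integrable one_le_two
  have hi : ∀ {f : X → ℝ}, MemLp f 2 μ →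
      Integrable (fun z => (avgIter K n f z - ∫ w, f w ∂μ) ^ 2) μ := fun hf =>
    ((memLp_two_avgIter hr hf n).sub (memLp_const _)).integrable_sq
  have i1 := hi hu
  have i2 := hi hv
  have i3 : Integrable (fun z => (avgIter K n (fun z => u z - v z) z
      - ∫ w, (u w - v w) ∂μ) ^ 2) μ := hi (hu.sub hv)
  rw [← integral_const_mul, ← integral_const_mul,
    ← integral_add (i2.const_mul 2) (i3.const_mul 2)]
  refine integral_mono_ae i1 ((i2.const_mul 2).add (i3.const_mul 2)) ?_
  filter_upwards [avgIter_sub hr hu1 hv1 n] with z hz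
  rw [hz, integral_sub hu1 hv1]
  nlinarith [sq_nonneg ((avgIter K n v z - ∫ w, v w ∂μ)
    - (avgIter K n u z - avgIter K n v z - (∫ w, u w ∂μ - ∫ w, v w ∂μ)))]

theorem MeanConv.add {u v : X → ℝ} (hu : MemLp u 2 μ) (hv : MemLp v 2 μ) (hu' : MeanConv K μ u)
    (hv' : MeanConv K μ v) : MeanConv K μ (fun z => u z + v z) := by
  have h := (Tendsto.const_mul 2 hv').add (Tendsto.const_mul 2 hu')
  simp only [mul_zero, add_zero] at h
  refine squeeze_zero (fun n => integral_nonneg fun z => sq_nonneg _) (fun n => ?_) h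
  have h1 := integral_sq_avgIter_sub_le hr (u := fun z => u z + v z) (hu.add hv) hv n
  simp only [add_sub_cancel_right] at h1
  exact h1

theorem MeanConv.of_approx {u : X → ℝ} (hu : MemLp u 2 μ)
    (h : ∀ ε > 0, ∃ v, MemLp v 2 μ ∧ MeanConv K μ v ∧ ∫ z, (u z - v z) ^ 2 ∂μ ≤ ε) :
    MeanConv K μ u := by
  rw [MeanConv, Metric.tendsto_atTop]
  intro ε hε
  -- Iterated averages contract `L²`, so the two errors contribute at most `2 * (ε / 8)` each.
  obtain ⟨v, hv, hvc, hve⟩ := h (ε / 8) (by positivity)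
  rw [MeanConv, Metric.tendsto_atTop] at hvc
  obtain ⟨N, hN⟩ := hvc (ε / 8) (by positivity)
  refine ⟨N, fun n hn => ?_⟩
  have h1 := hN n hn
  have h0 : ∀ f : X → ℝ, 0 ≤ ∫ z, (avgIter K n f z - ∫ w, f w ∂μ) ^ 2 ∂μ :=
    fun f => integral_nonneg fun z => sq_nonneg _
  rw [Real.dist_0_eq_abs, abs_of_nonneg (h0 _)] at h1 ⊢
  have h2 := integral_sq_avgIter_sub_le hr hu hv n
  have h3 := integral_sq_avgIter_sub hr (hu.sub hv) n
  have h4 := integral_sq_avgIter_le hr (hu.sub hv) n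
  simp only [Pi.sub_def] at h3 h4
  rw [h3] at h2
  nlinarith [sq_nonneg (∫ z, (u z - v z) ∂μ)]

omit [∀ n, IsMarkovKernel (K n)] hr in
theorem memLp_indicator_one {A : Set X} (hA : MeasurableSet A) :
    MemLp (A.indicator fun _ => (1 : ℝ)) 2 μ := (memLp_const 1).indicator hA

/-- The sets with convergent indicators form a Dynkin system: complements and finite disjoint unions
by linearity, countable ones by `L²` approximation. -/
theorem meanConv_indicator {C : Set (Set X)} (hC : ‹MeasurableSpace X› = MeasurableSpace.generateFrom C)
    (hpi : IsPiSystem C) (h : ∀ A ∈ C, MeanConv K μ (A.indicator fun _ => 1)) {A : Set X}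
    (hA : MeasurableSet A) : MeanConv K μ (A.indicator fun _ => 1) := by
  induction A, hA using MeasurableSpace.induction_on_inter hC hpi with
  | empty => simpa using meanConv_const (K := K) (μ := μ) 0
  | basic A hA => exact h A hA
  | compl A hA ih =>
    have e : (Aᶜ.indicator fun _ => (1 : ℝ)) = fun z => 1 + (-1) * A.indicator (fun _ => 1) z := by
      funext z
      by_cases hz : z ∈ A <;> simp [hz]
    rw [e]
    exact MeanConv.add hr (memLp_const 1) ((memLp_indicator_one hA).const_mul (-1))
      (meanConv_const 1) (ih.const_mul (-1))
  | iUnion f hd hm ih =>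
    have hB : ∀ N, MeasurableSet (⋃ k ∈ Finset.range N, f k) := fun N =>
      Finset.measurableSet_biUnion _ fun k _ => hm k
    have hfin : ∀ N, MeanConv K μ ((⋃ k ∈ Finset.range N, f k).indicator fun _ => 1) := by
      intro N
      induction N with
      | zero => simpa using meanConv_const (K := K) (μ := μ) 0
      | succ N ihN =>
        have e : ((⋃ k ∈ Finset.range (N + 1), f k).indicator fun _ => (1 : ℝ))
            = fun z => (⋃ k ∈ Finset.range N, f k).indicator (fun _ => (1 : ℝ)) z
              + (f N).indicator (fun _ => 1) z := by
          rw [Finset.range_add_one, Finset.set_biUnion_insert, Set.union_comm,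
            Set.indicator_union_of_disjoint]
          rw [Set.disjoint_left]
          intro z hz hz'
          simp only [Finset.mem_range, Set.mem_iUnion, exists_prop] at hz
          obtain ⟨k, hk, hzk⟩ := hz
          exact Set.disjoint_left.1 (hd hk.ne) hzk hz'
        rw [e]
        exact MeanConv.add hr (memLp_indicator_one (hB N)) (memLp_indicator_one (hm N)) ihN (ih N)
    have hlim : Tendsto (fun N => ∫ z, ((⋃ k, f k).indicator (fun _ => (1 : ℝ)) z
        - (⋃ k ∈ Finset.range N, f k).indicator (fun _ => 1) z) ^ 2 ∂μ) atTop
        (𝓝 (∫ _, (0 : ℝ) ∂μ)) := by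
      refine tendsto_integral_of_dominated_convergence (fun _ => 1) (fun N => ?_)
        (integrable_const 1) (fun N => ae_of_all _ fun z => ?_) (ae_of_all _ fun z => ?_)
      · exact (((memLp_indicator_one (MeasurableSet.iUnion hm)).sub
          (memLp_indicator_one (hB N))).1.pow 2)
      · have hI : ∀ B : Set X, B.indicator (fun _ => (1 : ℝ)) z ∈ Set.Icc 0 1 := fun B => by
          by_cases hz : z ∈ B <;> simp [hz]
        have h1 := hI (⋃ k, f k)
        have h2 := hI (⋃ k ∈ Finset.range N, f k)
        rw [Real.norm_eq_abs, abs_sq, sq_le_one_iff_abs_le_one, abs_le]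
        exact ⟨by linarith [h1.1, h2.2], by linarith [h1.2, h2.1]⟩
      · apply tendsto_const_nhds.congr'
        by_cases h1 : z ∈ ⋃ k, f k
        · obtain ⟨k, hk⟩ := Set.mem_iUnion.1 h1
          filter_upwards [eventually_gt_atTop k] with N hN
          have h2 : z ∈ ⋃ k ∈ Finset.range N, f k :=
            Set.mem_biUnion (by simpa using hN) hk
          simp only [Set.indicator_of_mem h1, Set.indicator_of_mem h2]
          norm_num
        · refine Eventually.of_forall fun N => ?_
          have h2 : z ∉ ⋃ k ∈ Finset.range N, f k := fun h2 =>
            h1 (Set.iUnion₂_subset_iUnion _ _ h2)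
          simp only [Set.indicator_of_notMem h1, Set.indicator_of_notMem h2]
          norm_num
    rw [integral_zero] at hlim
    refine MeanConv.of_approx hr (memLp_indicator_one (MeasurableSet.iUnion hm)) fun ε hε => ?_
    obtain ⟨N, hN⟩ := (hlim.eventually (Iic_mem_nhds hε)).exists
    exact ⟨_, memLp_indicator_one (hB N), hfin N, hN⟩

theorem meanConv_of_generateFrom {C : Set (Set X)}
    (hC : ‹MeasurableSpace X› = MeasurableSpace.generateFrom C)
    (hpi : IsPiSystem C) (h : ∀ A ∈ C, MeanConv K μ (A.indicator fun _ => 1)) {u : X → ℝ}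
    (hu : MemLp u 2 μ) : MeanConv K μ u := by
  refine MeanConv.of_approx hr hu fun ε hε => ?_
  have hind : ∀ (c : ℝ) ⦃A : Set X⦄, MeasurableSet A → μ A < ⊤ → ∀ {δ : ℝ≥0∞}, δ ≠ 0 →
      ∃ g : X → ℝ, eLpNorm (g - A.indicator fun _ => c) 2 μ ≤ δ ∧ MemLp g 2 μ ∧ MeanConv K μ g := by
    intro c A hA _ δ _
    refine ⟨A.indicator fun _ => c, by simp, (memLp_const c).indicator hA, ?_⟩
    have e : (A.indicator fun _ => c) = fun z => c * A.indicator (fun _ => (1 : ℝ)) z := by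
      funext z
      by_cases hz : z ∈ A <;> simp [hz]
    rw [e]
    exact (meanConv_indicator hr hC hpi h hA).const_mul c
  obtain ⟨v, hv, hv2, hvc⟩ := hu.induction_dense (by norm_num)
    (fun v => MemLp v 2 μ ∧ MeanConv K μ v) hind
    (fun f g hf hg => ⟨hf.1.add hg.1, MeanConv.add hr hf.1 hg.1 hf.2 hg.2⟩)
    (fun f hf => hf.1.1) (ε := ENNReal.ofReal (√ε)) (by simpa using hε)
  refine ⟨v, hv2, hvc, ?_⟩
  rw [eLpNorm_two_eq_ofReal_sqrt (hu.sub hv2), ENNReal.ofReal_le_ofReal_iff (Real.sqrt_nonneg _),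
    Real.sqrt_le_sqrt_iff hε.le] at hv
  exact hv

end

end BernoulliGauss

end

/-! ### Coordinate kernels on the product space. -/

noncomputable section

namespace BernoulliGauss

open Filter Topology

theorem measurePreserving_update {ι Y : Type*} [MeasurableSpace Y] [DecidableEq ι] (ν : Measure Y)
    [IsProbabilityMeasure ν] (i : ι) :
    MeasurePreserving (fun x : (ι → Y) × Y => Function.update x.1 i x.2)
      ((Measure.infinitePi fun _ : ι => ν).prod ν) (Measure.infinitePi fun _ : ι => ν) := by
  have hm : Measurable (fun x : (ι → Y) × Y => Function.update x.1 i x.2) := measurable_update'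
  refine ⟨hm, Measure.eq_infinitePi _ fun s t ht => ?_⟩
  rw [Measure.map_apply hm (MeasurableSet.pi s.countable_toSet fun j _ => ht j)]
  -- The constraint at `i` moves from the old point to the independent new value; the other
  -- constraints stay.
  have e : (fun x : (ι → Y) × Y => Function.update x.1 i x.2) ⁻¹' (Set.pi s t)
      = (Set.pi (s.erase i) t) ×ˢ (if i ∈ s then t i else Set.univ) := by
    ext ⟨x, y⟩
    simp only [Set.mem_preimage, Set.mem_pi, Set.mem_prod, Finset.mem_coe, Finset.mem_erase]
    constructor
    · intro h
      refine ⟨fun j hj => by simpa [Function.update_of_ne hj.1] using h j hj.2, ?_⟩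
      split_ifs with hi
      · simpa using h i hi
      · trivial
    · rintro ⟨h1, h2⟩ j hj
      by_cases hji : j = i
      · subst hji
        simpa [hj] using h2
      · simpa [Function.update_of_ne hji] using h1 j ⟨hji, hj⟩
  rw [e, Measure.prod_prod, Measure.infinitePi_pi _ fun j _ => ht j]
  split_ifs with hi
  · rw [mul_comm, Finset.mul_prod_erase s (fun j => ν (t j)) hi]
  · rw [measure_univ, mul_one, Finset.erase_eq_of_notMem hi]

variable {S : Type*} {p : I}

instance : IsProbabilityMeasure (ber p) := by unfold ber; infer_instance

instance : IsProbabilityMeasure (mu S p) := by unfold mu; infer_instance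

open Classical in
/-- Replace the Bernoulli coordinate `s` by `b`. -/
def updBer (s : S) (z : Space S) (b : Bool) : Space S := (Function.update z.1 s b, z.2)

/-- Replace the Gaussian coordinate `i` by `t`. -/
def updGauss (i : ℕ) (z : Space S) (t : ℝ) : Space S := (z.1, Function.update z.2 i t)

theorem measurable_updBer (s : S) : Measurable (Function.uncurry (updBer s)) := by
  classical
  exact (measurable_update'.comp
    ((measurable_fst.comp measurable_fst).prodMk measurable_snd)).prodMk
      (measurable_snd.comp measurable_fst)

theorem measurable_updGauss (i : ℕ) : Measurable (Function.uncurry (updGauss (S := S) i)) :=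
  (measurable_fst.comp measurable_fst).prodMk (measurable_update'.comp
    ((measurable_snd.comp measurable_fst).prodMk measurable_snd))

theorem measurePreserving_updGauss (i : ℕ) :
    MeasurePreserving (Function.uncurry (updGauss i)) ((mu S p).prod gauss) (mu S p) := by
  have h1 := measurePreserving_prodAssoc (Measure.infinitePi fun _ : S => ber p)
    (Measure.infinitePi fun _ : ℕ => gauss) gauss
  have h2 := (MeasurePreserving.id (Measure.infinitePi fun _ : S => ber p)).prod
    (measurePreserving_update gauss i)
  exact h2.comp h1

theorem measurePreserving_updBer (s : S) :
    MeasurePreserving (Function.uncurry (updBer s)) ((mu S p).prod (ber p)) (mu S p) := by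
  classical
  have h1 := measurePreserving_prodAssoc (Measure.infinitePi fun _ : S => ber p)
    (Measure.infinitePi fun _ : ℕ => gauss) (ber p)
  have h2 := (MeasurePreserving.id (Measure.infinitePi fun _ : S => ber p)).prod
    (Measure.measurePreserving_swap (μ := Measure.infinitePi fun _ : ℕ => gauss) (ν := ber p))
  have h3 := (measurePreserving_prodAssoc (Measure.infinitePi fun _ : S => ber p) (ber p)
    (Measure.infinitePi fun _ : ℕ => gauss)).symm
  have h4 := (measurePreserving_update (ber p) s).prod
    (MeasurePreserving.id (Measure.infinitePi fun _ : ℕ => gauss))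
  -- The factors are permuted to bring the fresh bit next to the Bernoulli coordinates.
  have h5 := h4.comp (h3.comp (h2.comp h1))
  convert! h5 using 1

/-- The kernel that resamples one coordinate. -/
def coordKernel (p : I) : S ⊕ ℕ → Kernel (Space S) (Space S)
  | .inl s => resample (updBer s) (ber p) (measurable_updBer s)
  | .inr i => resample (updGauss i) gauss (measurable_updGauss i)

instance (j : S ⊕ ℕ) : IsMarkovKernel (coordKernel p j) := by
  cases j <;> unfold coordKernel <;> infer_instance

theorem isResampling_coordKernel (j : S ⊕ ℕ) : IsResampling (coordKernel p j) (mu S p) := by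
  cases j with
  | inl s =>
    exact isResampling_resample (hU := measurable_updBer s) (measurePreserving_updBer s)
      fun z a b => by simp [updBer]
  | inr i =>
    exact isResampling_resample (hU := measurable_updGauss i) (measurePreserving_updGauss i)
      fun z a b => by simp [updGauss]

theorem coordKernel_comm (j k : S ⊕ ℕ) :
    coordKernel p j ∘ₖ coordKernel p k = coordKernel p k ∘ₖ coordKernel p j := by
  classical
  by_cases h : j = k
  · rw [h]
  rcases j with s | i <;> rcases k with s' | i'
  · refine resample_comp_comm (hU := measurable_updBer s') (hV := measurable_updBer s)
      fun z a b => ?_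
    simp only [updBer]
    exact Prod.ext (Function.update_comm (fun e => h (by rw [e])) _ _ _) rfl
  · exact resample_comp_comm (hU := measurable_updGauss i') (hV := measurable_updBer s)
      fun z a b => rfl
  · exact resample_comp_comm (hU := measurable_updBer s') (hV := measurable_updGauss i)
      fun z a b => rfl
  · refine resample_comp_comm (hU := measurable_updGauss i') (hV := measurable_updGauss i)
      fun z a b => ?_
    simp only [updGauss]
    rw [Function.update_comm fun e => h (by rw [e])]

theorem avg_coordKernel_inl {f : Space S → ℝ} (hf : StronglyMeasurable f) (s : S) (z : Space S) :
    avg (coordKernel p (.inl s)) f z = ∫ b, f (updBer s z b) ∂(ber p) :=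
  integral_resample (hU := measurable_updBer s) hf z

theorem avg_coordKernel_inr {f : Space S → ℝ} (hf : StronglyMeasurable f) (i : ℕ) (z : Space S) :
    avg (coordKernel p (.inr i)) f z = ∫ t, f (updGauss i z t) ∂gauss :=
  integral_resample (hU := measurable_updGauss i) hf z

/-- Two points have the same coordinates in `J`. -/
def AgreeOn (J : Set (S ⊕ ℕ)) (z z' : Space S) : Prop :=
  (∀ s, .inl s ∈ J → z.1 s = z'.1 s) ∧ ∀ i, .inr i ∈ J → z.2 i = z'.2 i

/-- Integrating over coordinate `j` removes it from the set of coordinates on which the function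
depends. -/
theorem avg_coordKernel_eq_of_agreeOn {f : Space S → ℝ} (hf : StronglyMeasurable f)
    {J : Set (S ⊕ ℕ)} (h : ∀ z z', AgreeOn J z z' → f z = f z') (j : S ⊕ ℕ) {z z' : Space S}
    (hz : AgreeOn (J \ {j}) z z') :
    avg (coordKernel p j) f z = avg (coordKernel p j) f z' := by
  classical
  rcases j with s | i
  · rw [avg_coordKernel_inl hf, avg_coordKernel_inl hf]
    congr 1 with b
    refine h _ _ ⟨fun s' hs' => ?_, fun i hi => hz.2 i ⟨hi, by simp⟩⟩
    by_cases hss : s' = s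
    · simp [updBer, hss]
    · simpa [updBer, hss] using hz.1 s' ⟨hs', by simpa using hss⟩
  · rw [avg_coordKernel_inr hf, avg_coordKernel_inr hf]
    congr 1 with t
    refine h _ _ ⟨fun s hs => hz.1 s ⟨hs, by simp⟩, fun i' hi' => ?_⟩
    by_cases hii : i' = i
    · simp [updGauss, hii]
    · simpa [updGauss, hii] using hz.2 i' ⟨hi', by simpa using hii⟩

theorem avgIter_eq_of_agreeOn (e : ℕ ≃ S ⊕ ℕ) {f : Space S → ℝ} (hf : StronglyMeasurable f)
    {J : Set (S ⊕ ℕ)} (h : ∀ z z', AgreeOn J z z' → f z = f z') (n : ℕ) {z z' : Space S}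
    (hz : AgreeOn {j ∈ J | n ≤ e.symm j} z z') :
    avgIter (fun n => coordKernel p (e n)) n f z = avgIter (fun n => coordKernel p (e n)) n f z' := by
  induction n generalizing z z' with
  | zero => exact h z z' (by simpa using hz)
  | succ n ih =>
    refine avg_coordKernel_eq_of_agreeOn (stronglyMeasurable_avgIter hf n)
      (J := {j ∈ J | n ≤ e.symm j}) (fun z z' hz => ih hz) (e n) ?_
    have hJ : {j ∈ J | n ≤ e.symm j} \ {e n} ⊆ {j ∈ J | n + 1 ≤ e.symm j} := by
      rintro j ⟨⟨h1, h2⟩, h3⟩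
      refine ⟨h1, lt_of_le_of_ne h2 fun h4 => h3 ?_⟩
      rw [h4]
      simp
    exact ⟨fun s hs => hz.1 s (hJ hs), fun i hi => hz.2 i (hJ hi)⟩

/-- Once all coordinates in `J` have been averaged out, the iterated average is constant, hence
equal to the mean. -/
theorem meanConv_of_agreeOn_finite (e : ℕ ≃ S ⊕ ℕ) {f : Space S → ℝ} (hf : StronglyMeasurable f)
    (hf2 : MemLp f 2 (mu S p)) {J : Set (S ⊕ ℕ)} (hJ : J.Finite)
    (h : ∀ z z', AgreeOn J z z' → f z = f z') :
    MeanConv (fun n => coordKernel p (e n)) (mu S p) f := by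
  obtain ⟨N, hN⟩ := (hJ.image e.symm).bddAbove
  refine tendsto_const_nhds.congr' ?_
  filter_upwards [eventually_gt_atTop N] with n hn
  have hr : ∀ n, IsResampling (coordKernel p (e n)) (mu S p) := fun n => isResampling_coordKernel _
  have hconst : ∀ z z', avgIter (fun n => coordKernel p (e n)) n f z
      = avgIter (fun n => coordKernel p (e n)) n f z' := fun z z' => by
    refine avgIter_eq_of_agreeOn e hf h n ?_
    have hempty : {j ∈ J | n ≤ e.symm j} = ∅ := by
      ext j
      simp only [Set.mem_ofPred_eq, Set.mem_empty_iff_false, iff_false, not_and, not_le]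
      exact fun hj => (hN ⟨j, hj, rfl⟩).trans_lt hn
    rw [hempty]
    exact ⟨fun s hs => hs.elim, fun i hi => hi.elim⟩
  have hint := integral_avgIter hr (hf2.integrable one_le_two) n
  have hval : ∀ z, avgIter (fun n => coordKernel p (e n)) n f z = ∫ w, f w ∂(mu S p) := fun z => by
    rw [← hint, integral_congr_ae (ae_of_all _ fun w => hconst w z)]
    simp
  simp [hval]

theorem isResamplingFamily_coordKernel (e : ℕ ≃ S ⊕ ℕ) :
    IsResamplingFamily (fun n => coordKernel p (e n)) (mu S p) where
  isResampling n := isResampling_coordKernel _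
  comm m n := coordKernel_comm _ _
  tendsto u hu := by
    refine meanConv_of_generateFrom (fun n => isResampling_coordKernel _)
      (C := Set.image2 (· ×ˢ ·) (measurableCylinders fun _ : S => Bool)
        (measurableCylinders fun _ : ℕ => ℝ)) ?_ ?_ ?_ hu
    · exact (generateFrom_eq_prod generateFrom_measurableCylinders
        generateFrom_measurableCylinders
        ⟨fun _ => Set.univ, fun _ => univ_mem_measurableCylinders _, Set.iUnion_const _⟩
        ⟨fun _ => Set.univ, fun _ => univ_mem_measurableCylinders _, Set.iUnion_const _⟩).symm
    · exact isPiSystem_measurableCylinders.prod isPiSystem_measurableCylinders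
    · rintro _ ⟨A, hA, B, hB, rfl⟩
      have hm : MeasurableSet (A ×ˢ B) := (MeasurableSet.of_mem_measurableCylinders hA).prod
        (MeasurableSet.of_mem_measurableCylinders hB)
      obtain ⟨s, A', hA', rfl⟩ := (mem_measurableCylinders _).1 hA
      obtain ⟨t, B', hB', rfl⟩ := (mem_measurableCylinders _).1 hB
      refine meanConv_of_agreeOn_finite e (stronglyMeasurable_const.indicator hm)
        (memLp_indicator_one hm) (J := Sum.inl '' (s : Set S) ∪ Sum.inr '' (t : Set ℕ))
        ((s.finite_toSet.image _).union (t.finite_toSet.image _)) fun z z' hz => ?_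
      have e1 : s.restrict z.1 = s.restrict z'.1 := by
        funext i
        exact hz.1 i (Or.inl ⟨i, i.2, rfl⟩)
      have e2 : t.restrict z.2 = t.restrict z'.2 := by
        funext i
        exact hz.2 i (Or.inr ⟨i, i.2, rfl⟩)
      have e3 : z ∈ cylinder s A' ×ˢ cylinder t B' ↔ z' ∈ cylinder s A' ×ˢ cylinder t B' := by
        simp only [Set.mem_prod, mem_cylinder]
        rw [e1, e2]
      by_cases hz' : z' ∈ cylinder s A' ×ˢ cylinder t B'
      · rw [Set.indicator_of_mem hz', Set.indicator_of_mem (e3.2 hz')]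
      · rw [Set.indicator_of_notMem hz', Set.indicator_of_notMem fun h => hz' (e3.1 h)]

end BernoulliGauss

end

/-! ### Partial gradients and one-coordinate inequalities on the product space. -/

noncomputable section

namespace BernoulliGauss

open Filter Topology

theorem EntBound.map {X Ω : Type*} [MeasurableSpace X] [MeasurableSpace Ω] {ν : Measure Ω}
    {U : Ω → X} (hU : Measurable U) {g : X → ℝ} (hg : StronglyMeasurable g) {E : ℝ}
    (h : EntBound ν (fun s => g (U s)) E) : EntBound (ν.map U) g E := by
  rintro ψ hψ ⟨C, hC⟩
  have h1 := h (fun s => ψ (U s)) (hψ.comp hU) ⟨C, fun s => hC _⟩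
  have h2 : Measurable fun x => g x ^ 2 * ψ x := (hg.measurable.pow_const 2).mul hψ
  rwa [integral_map hU.aemeasurable h2.aestronglyMeasurable,
    integral_map hU.aemeasurable (hg.measurable.pow_const 2).aestronglyMeasurable,
    integral_map hU.aemeasurable hψ.exp.aestronglyMeasurable]

variable {S : Type*} {p : I}

theorem isPartialDeriv_avg_resample {Ω : Type*} [MeasurableSpace Ω] {ν : Measure Ω}
    [IsProbabilityMeasure ν] {U : Space S → Ω → Space S} {hU : Measurable (Function.uncurry U)}
    (hκ : IsResampling (resample U ν hU) (mu S p))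
    (hmp : MeasurePreserving (Function.uncurry U) ((mu S p).prod ν) (mu S p)) {i : ℕ}
    (hc : ∀ z a t, updGauss i (U z a) t = U (updGauss i z t) a) {g G : Space S → ℝ}
    (hg : StronglyMeasurable g) (hg2 : MemLp g 2 (mu S p)) (hG : StronglyMeasurable G)
    (h : IsPartialDeriv p i g G) :
    IsPartialDeriv p i (avg (resample U ν hU) g) (avg (resample U ν hU) G) := by
  have hr : ∀ u : Space S → ℝ, StronglyMeasurable u → ∀ z t,
      avg (resample U ν hU) u (updGauss i z t) = ∫ a, u (updGauss i (U z a) t) ∂ν :=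
    fun u hu z t => by
      simp_rw [hc]
      exact integral_resample hu _
  -- Resampling by `U` and then coordinate `i` preserves the measure; this gives the joint
  -- integrability in the parameter and `y_i` that `HasWeakDeriv.integral` needs.
  have hT := ((measurePreserving_updGauss (p := p) i).comp
    (hmp.prod (MeasurePreserving.id gauss))).comp
      (measurePreserving_prodAssoc (mu S p) ν gauss).symm
  have hint : ∀ u : Space S → ℝ, Integrable u (mu S p) → ∀ᵐ z ∂(mu S p),
      Integrable (fun x : Ω × ℝ => u (updGauss i (U z x.1) x.2)) (ν.prod gauss) :=
    fun u hu => (hT.integrable_comp_of_integrable hu).prod_right_ae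
  refine ⟨hκ.memLp_two_avg h.1, ?_⟩
  have hline := Measure.ae_ae_of_ae_prod (hmp.quasiMeasurePreserving.ae h.2)
  filter_upwards [hline, hint g (hg2.integrable one_le_two), hint G (h.1.integrable one_le_two)]
    with z h1 h2 h3
  have := HasWeakDeriv.integral h2 h3 h1
  simp_rw [← hr g hg, ← hr G hG] at this
  exact this

/-- The logarithmic Sobolev constant of one coordinate. -/
def coordConst (p : I) : S ⊕ ℕ → ℝ
  | .inl _ => cLS p
  | .inr _ => 2

/-- `G` is the partial gradient of `g` with respect to one coordinate. -/
def coordGrad (p : I) : S ⊕ ℕ → (Space S → ℝ) → (Space S → ℝ) → Prop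
  | .inl s, g, G => StronglyMeasurable g ∧ MemLp g 2 (mu S p) ∧ MemLp G 2 (mu S p) ∧
      G =ᵐ[mu S p] fun z => g z - avg (coordKernel p (.inl s)) g z
  | .inr i, g, G => StronglyMeasurable g ∧ MemLp g 2 (mu S p) ∧ StronglyMeasurable G ∧
      IsPartialDeriv p i g G

theorem coordGrad.stronglyMeasurable {j : S ⊕ ℕ} {g G : Space S → ℝ} (h : coordGrad p j g G) :
    StronglyMeasurable g := by
  cases j <;> exact h.1

theorem coordGrad.memLp {j : S ⊕ ℕ} {g G : Space S → ℝ} (h : coordGrad p j g G) :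
    MemLp g 2 (mu S p) := by
  cases j <;> exact h.2.1

theorem coordGrad.memLp_grad {j : S ⊕ ℕ} {g G : Space S → ℝ} (h : coordGrad p j g G) :
    MemLp G 2 (mu S p) := by
  cases j
  · exact h.2.2.1
  · exact h.2.2.2.1

theorem coordGrad.sub {j : S ⊕ ℕ} {g g' G G' : Space S → ℝ} (h : coordGrad p j g G)
    (h' : coordGrad p j g' G') :
    coordGrad p j (fun z => g z - g' z) (fun z => G z - G' z) := by
  rcases j with s | i
  · refine ⟨h.1.sub h'.1, h.2.1.sub h'.2.1, h.2.2.1.sub h'.2.2.1, ?_⟩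
    filter_upwards [h.2.2.2, h'.2.2.2, (isResampling_coordKernel (p := p) (.inl s)).avg_sub
      (h.2.1.integrable one_le_two) (h'.2.1.integrable one_le_two)] with z h1 h2 h3
    rw [h1, h2, h3]
    ring
  · refine ⟨h.1.sub h'.1, h.2.1.sub h'.2.1, h.2.2.1.sub h'.2.2.1, h.2.2.2.1.sub h'.2.2.2.1, ?_⟩
    filter_upwards [h.2.2.2.2, h'.2.2.2.2] with z h1 h2 using h1.sub h2

/-- Averages over different coordinates commute, but only almost everywhere for integrable
functions; this is why `coordGrad` fixes a Bernoulli gradient only up to null sets. -/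
theorem coordGrad.avg_of_ne {j k : S ⊕ ℕ} (hjk : k ≠ j) {g G : Space S → ℝ}
    (h : coordGrad p j g G) :
    coordGrad p j (avg (coordKernel p k) g) (avg (coordKernel p k) G) := by
  have hk := isResampling_coordKernel (p := p) k
  rcases j with s | i
  · have hs := isResampling_coordKernel (p := p) (.inl s)
    have hi := h.2.1.integrable one_le_two
    refine ⟨stronglyMeasurable_avg h.1, hk.memLp_two_avg h.2.1, hk.memLp_two_avg h.2.2.1, ?_⟩
    filter_upwards [hk.avg_congr h.2.2.2, hk.avg_sub hi (hs.integrable_avg hi),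
      avg_comm hk hs (coordKernel_comm _ _) hi] with z h1 h2 h3
    rw [h1, h2, h3]
  · refine ⟨stronglyMeasurable_avg h.1, hk.memLp_two_avg h.2.1, stronglyMeasurable_avg h.2.2.1, ?_⟩
    rcases k with s | i'
    · exact isPartialDeriv_avg_resample (hU := measurable_updBer s) hk
        (measurePreserving_updBer s) (fun z a t => rfl) h.1 h.2.1 h.2.2.1 h.2.2.2
    · refine isPartialDeriv_avg_resample (hU := measurable_updGauss i') hk
        (measurePreserving_updGauss i') (fun z a t => ?_) h.1 h.2.1 h.2.2.1 h.2.2.2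
      simp only [updGauss]
      rw [Function.update_comm fun e => hjk (by rw [e])]

theorem coordGrad.avg_self {j : S ⊕ ℕ} {g G : Space S → ℝ} (h : coordGrad p j g G) :
    coordGrad p j (avg (coordKernel p j) g) (fun _ => 0) := by
  have hj := isResampling_coordKernel (p := p) j
  rcases j with s | i
  · refine ⟨stronglyMeasurable_avg h.1, hj.memLp_two_avg h.2.1, MemLp.zero, ae_of_all _ fun z => ?_⟩
    have : avg (coordKernel p (.inl s)) (avg (coordKernel p (.inl s)) g) z
        = ∫ _, avg (coordKernel p (.inl s)) g z ∂(coordKernel p (.inl s) z) :=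
      integral_congr_ae (hj.ae_avg_eq g h.1 z)
    simp [this]
  · refine ⟨stronglyMeasurable_avg h.1, hj.memLp_two_avg h.2.1, stronglyMeasurable_const,
      MemLp.zero, ae_of_all _ fun z => ?_⟩
    have : (fun t => avg (coordKernel p (.inr i)) g (z.1, Function.update z.2 i t))
        = fun _ => avg (coordKernel p (.inr i)) g z := by
      funext t
      simp [avg_coordKernel_inr h.1, updGauss]
    rw [this]
    exact hasWeakDeriv_const _

/-- On the fibre through `z` the kernel is the image of `ber p` or `gauss`, so the one-dimensional
inequality is pushed forward. -/
theorem coordGrad.entBound (hp0 : 0 < p) (hp1 : p < 1) {j : S ⊕ ℕ} {g G : Space S → ℝ}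
    (h : coordGrad p j g G) :
    ∀ᵐ z ∂(mu S p), EntBound (coordKernel p j z) g
      (coordConst p j * ∫ w, G w ^ 2 ∂(coordKernel p j z)) := by
  have hj := isResampling_coordKernel (p := p) j
  rcases j with s | i
  · filter_upwards [hj.ae_ae h.2.2.2] with z hz
    have hU : Measurable (updBer s z) := (measurable_updBer s).of_uncurry_left
    have e1 : ∫ w, G w ^ 2 ∂(coordKernel p (.inl s) z)
        = ∫ b, (g (updBer s z b) - ∫ b', g (updBer s z b') ∂(ber p)) ^ 2 ∂(ber p) := by
      have : ∫ w, G w ^ 2 ∂(coordKernel p (.inl s) z)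
          = ∫ w, (g w - avg (coordKernel p (.inl s)) g z) ^ 2 ∂(coordKernel p (.inl s) z) := by
        refine integral_congr_ae ?_
        filter_upwards [hz, hj.ae_avg_eq g h.1 z] with w h1 h2
        rw [h1, h2]
      rw [this, avg_coordKernel_inl h.1]
      exact integral_map hU.aemeasurable
        ((h.1.measurable.sub_const _).pow_const 2).aestronglyMeasurable
    rw [e1]
    exact EntBound.map hU h.1 (entBound_ber hp0 hp1 _)
  · filter_upwards [hj.ae_memLp_two h.2.1, hj.ae_memLp_two h.2.2.2.1, h.2.2.2.2] with z h1 h2 h3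
    have hU : Measurable (updGauss i z) := (measurable_updGauss i).of_uncurry_left
    have e1 : ∫ w, G w ^ 2 ∂(coordKernel p (.inr i) z) = ∫ t, G (updGauss i z t) ^ 2 ∂gauss :=
      integral_map hU.aemeasurable (h.2.2.1.measurable.pow_const 2).aestronglyMeasurable
    rw [e1]
    exact EntBound.map hU h.1 (entBound_gauss
      ((memLp_map_measure_iff h.1.aestronglyMeasurable hU.aemeasurable).1 h1)
      ((memLp_map_measure_iff h.2.2.1.aestronglyMeasurable hU.aemeasurable).1 h2) h3)

theorem isLogSobolev_coordGrad (hp0 : 0 < p) (hp1 : p < 1) (e : ℕ ≃ S ⊕ ℕ) :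
    IsLogSobolev (fun n => coordKernel p (e n)) (mu S p) (fun n => coordConst p (e n))
      (fun n => coordGrad p (e n)) where
  nonneg n := by
    rcases e n with s | i
    · exact (cLS_pos hp0 hp1).le
    · exact zero_le_two
  stronglyMeasurable h := h.stronglyMeasurable
  memLp h := h.memLp
  memLp_grad h := h.memLp_grad
  sub h h' := h.sub h'
  avg_of_ne hmn h := h.avg_of_ne (e.injective.ne hmn)
  avg_self h := h.avg_self
  entBound h := h.entBound hp0 hp1

end BernoulliGauss

end

/-! ### Optimization in `t` and passage to extended reals. -/

noncomputable section

namespace BernoulliGauss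

open Filter Topology

theorem summable_of_tsum_ofReal_ne_top {ι : Type*} {a : ι → ℝ} (ha : ∀ j, 0 ≤ a j)
    (h : ∑' j, ENNReal.ofReal (a j) ≠ ⊤) : Summable a := by
  simpa [ENNReal.toReal_ofReal (ha _)] using ENNReal.summable_toReal h

/-- The optimization over the free parameter `t`, in the extended reals. -/
theorem ofReal_mul_log_le {ι : Type*} {a b : ι → ℝ} (ha : ∀ j, 0 ≤ a j) (hb : ∀ j, 0 ≤ b j) {V : ℝ}
    (h : Summable a → Summable b → ∀ t, 0 < t → V * (1 + Real.log t) ≤ ∑' j, a j + t * ∑' j, b j) :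
    ((ENNReal.ofReal V : ℝ≥0∞) : EReal) *
        ENNReal.log (ENNReal.ofReal V / ∑' j, ENNReal.ofReal (b j))
      ≤ ((∑' j, ENNReal.ofReal (a j) : ℝ≥0∞) : EReal) := by
  rcases le_or_gt V 0 with hV | hV
  · rw [ENNReal.ofReal_of_nonpos hV]
    simpa using EReal.coe_ennreal_nonneg _
  have hV' : ((ENNReal.ofReal V : ℝ≥0∞) : EReal) = (V : EReal) := by
    rw [EReal.coe_ennreal_ofReal, max_eq_left hV.le]
  by_cases hR : ∑' j, ENNReal.ofReal (a j) = ⊤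
  · rw [hR]
    exact le_top
  by_cases hD : ∑' j, ENNReal.ofReal (b j) = ⊤
  · rw [hD, ENNReal.div_top, ENNReal.log_zero, hV', EReal.coe_mul_bot_of_pos hV]
    exact bot_le
  have sa := summable_of_tsum_ofReal_ne_top ha hR
  have sb := summable_of_tsum_ofReal_ne_top hb hD
  have h' := h sa sb
  rw [← ENNReal.ofReal_tsum_of_nonneg ha sa, ← ENNReal.ofReal_tsum_of_nonneg hb sb]
  have hR0 : 0 ≤ ∑' j, a j := tsum_nonneg ha
  rcases (tsum_nonneg hb : 0 ≤ ∑' j, b j).eq_or_lt with hD0 | hD0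
  · exfalso
    -- If the `b j` sum to zero and `V > 0`, this `t` gives `V + ∑ a ≤ ∑ a`, which is absurd; the
    -- division by zero does not arise.
    have h1 := h' (Real.exp ((∑' j, a j) / V)) (Real.exp_pos _)
    rw [Real.log_exp, ← hD0, mul_zero, mul_add, mul_div_cancel₀ _ hV.ne'] at h1
    linarith
  -- The optimal `t`: the summand `V` on the left cancels `t * ∑ b = V` on the right.
  · have h1 := h' (V / ∑' j, b j) (div_pos hV hD0)
    rw [div_mul_cancel₀ _ hD0.ne'] at h1
    rw [← ENNReal.ofReal_div_of_pos hD0, ENNReal.log_ofReal_of_pos (div_pos hV hD0), hV',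
      EReal.coe_ennreal_ofReal, max_eq_left hR0, ← EReal.coe_mul, EReal.coe_le_coe_iff]
    linarith

variable {S : Type*} {p : I}

theorem variance_mul_log_le [Countable S] (hp0 : 0 < p) (hp1 : p < 1) {f : Space S → ℝ}
    {G : S ⊕ ℕ → Space S → ℝ} (hf2 : MemLp f 2 (mu S p)) (hG : ∀ j, coordGrad p j f (G j)) :
    ((evariance f (mu S p) : ℝ≥0∞) : EReal) * ENNReal.log (evariance f (mu S p) /
        ∑' j, ENNReal.ofReal ((∫ z, |f z - avg (coordKernel p j) f z| ∂(mu S p)) ^ 2))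
      ≤ ((∑' j, ENNReal.ofReal (coordConst p j * ∫ z, G j z ^ 2 ∂(mu S p)) : ℝ≥0∞) : EReal) := by
  -- The summand `ℕ` makes the index set infinite, so even for finite or empty `S` it is enumerated
  -- by `ℕ`.
  obtain ⟨_⟩ := nonempty_denumerable (S ⊕ ℕ)
  let e : ℕ ≃ S ⊕ ℕ := (Denumerable.eqv (S ⊕ ℕ)).symm
  have hc := (isLogSobolev_coordGrad hp0 hp1 e).nonneg
  have hc' : ∀ j : S ⊕ ℕ, 0 ≤ coordConst p j := fun j => by simpa using hc (e.symm j)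
  rw [← ofReal_variance hf2]
  refine ofReal_mul_log_le (fun j => mul_nonneg (hc' j) (integral_nonneg fun z => sq_nonneg _))
    (fun j => sq_nonneg _) fun sa sb t ht => ?_
  rw [← e.tsum_eq, ← e.tsum_eq (fun j => (∫ z, |f z - avg (coordKernel p j) f z| ∂(mu S p)) ^ 2),
    variance_eq_sub hf2]
  exact (isLogSobolev_coordGrad hp0 hp1 e).variance_mul_le (isResamplingFamily_coordKernel e)
    (fun n => hG (e n)) (e.summable_iff.2 sa)
    (fun N => (e.summable_iff.2 sb).sum_le_tsum _ fun n _ => sq_nonneg _) ht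

theorem deltaBer_congr {f f' : Space S → ℝ} (h : f =ᵐ[mu S p] f') (s : S) :
    deltaBer p s f =ᵐ[mu S p] deltaBer p s f' := by
  filter_upwards [h, Measure.ae_ae_of_ae_prod
    ((measurePreserving_updBer s).quasiMeasurePreserving.ae h)] with z h1 h2
  unfold deltaBer
  rw [h1]
  exact congrArg _ (integral_congr_ae h2)

theorem deltaGauss_congr {f f' : Space S → ℝ} (h : f =ᵐ[mu S p] f') (i : ℕ) :
    deltaGauss i f =ᵐ[mu S p] deltaGauss i f' := by
  filter_upwards [h, Measure.ae_ae_of_ae_prod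
    ((measurePreserving_updGauss i).quasiMeasurePreserving.ae h)] with z h1 h2
  unfold deltaGauss
  rw [h1]
  exact congrArg _ (integral_congr_ae h2)

theorem IsPartialDeriv.congr {f f' h h' : Space S → ℝ} {i : ℕ} (H : IsPartialDeriv p i f h)
    (hf : f =ᵐ[mu S p] f') (hh : h =ᵐ[mu S p] h') : IsPartialDeriv p i f' h' := by
  refine ⟨(memLp_congr_ae hh).1 H.1, ?_⟩
  filter_upwards [H.2, Measure.ae_ae_of_ae_prod
    ((measurePreserving_updGauss i).quasiMeasurePreserving.ae hf), Measure.ae_ae_of_ae_prod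
    ((measurePreserving_updGauss i).quasiMeasurePreserving.ae hh)] with z h1 h2 h3
  exact h1.congr (volume_absolutelyContinuous_gauss.ae_le h2)
    (volume_absolutelyContinuous_gauss.ae_le h3)

theorem energy_congr {f f' : Space S → ℝ} (h : f =ᵐ[mu S p] f') : energy p f = energy p f' :=
  lintegral_congr_ae (h.mono fun z hz => by simp only [hz])

theorem energy_eq_ofReal_integral {f : Space S → ℝ} (hf : MemLp f 2 (mu S p)) :
    energy p f = ENNReal.ofReal (∫ z, f z ^ 2 ∂(mu S p)) :=
  (ofReal_integral_eq_lintegral_ofReal hf.integrable_sq (ae_of_all _ fun _ => sq_nonneg _)).symm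

theorem eLpNorm_one_sq {f : Space S → ℝ} (hf : Integrable f (mu S p)) :
    eLpNorm f 1 (mu S p) ^ 2 = ENNReal.ofReal ((∫ z, |f z| ∂(mu S p)) ^ 2) := by
  rw [eLpNorm_one_eq_lintegral_enorm, ← ofReal_integral_norm_eq_lintegral_enorm hf,
    ENNReal.ofReal_pow (integral_nonneg fun z => abs_nonneg _)]
  rfl

theorem deltaBer_eq {f : Space S → ℝ} (hf : StronglyMeasurable f) (s : S) :
    deltaBer p s f = fun z => f z - avg (coordKernel p (.inl s)) f z := by
  funext z
  rw [avg_coordKernel_inl hf]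
  rfl

theorem deltaGauss_eq {f : Space S → ℝ} (hf : StronglyMeasurable f) (i : ℕ) :
    deltaGauss i f = fun z => f z - avg (coordKernel p (.inr i)) f z := by
  funext z
  rw [avg_coordKernel_inr hf]
  rfl

theorem evariance_mul_log_le_of_stronglyMeasurable [Countable S] (hp0 : 0 < p) (hp1 : p < 1)
    {f : Space S → ℝ} (hf : StronglyMeasurable f) (hf2 : MemLp f 2 (mu S p))
    {df : ℕ → Space S → ℝ} (hdf : ∀ i, StronglyMeasurable (df i))
    (H : ∀ i, IsPartialDeriv p i f (df i)) :
    ((evariance f (mu S p) : ℝ≥0∞) : EReal) * ENNReal.log (evariance f (mu S p) /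
        ((∑' s : S, eLpNorm (deltaBer p s f) 1 (mu S p) ^ 2) +
          ∑' i : ℕ, eLpNorm (deltaGauss i f) 1 (mu S p) ^ 2))
      ≤ ((ENNReal.ofReal (cLS p) * (∑' s : S, energy p (deltaBer p s f)) +
          2 * ∑' i : ℕ, energy p (df i) : ℝ≥0∞) : EReal) := by
  have hr : ∀ j : S ⊕ ℕ, IsResampling (coordKernel p j) (mu S p) := isResampling_coordKernel
  have hd : ∀ j : S ⊕ ℕ, MemLp (fun z => f z - avg (coordKernel p j) f z) 2 (mu S p) := fun j =>
    hf2.sub ((hr j).memLp_two_avg hf2)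
  let G : S ⊕ ℕ → Space S → ℝ := Sum.elim (fun s => deltaBer p s f) df
  have hG : ∀ j, coordGrad p j f (G j) := by
    rintro (s | i)
    · have : G (.inl s) = fun z => f z - avg (coordKernel p (.inl s)) f z := deltaBer_eq hf s
      rw [this]
      exact ⟨hf, hf2, hd _, ae_eq_refl _⟩
    · exact ⟨hf, hf2, hdf i, H i⟩
  have key := variance_mul_log_le hp0 hp1 hf2 hG
  rw [Summable.tsum_sum ENNReal.summable ENNReal.summable,
    Summable.tsum_sum ENNReal.summable ENNReal.summable] at key
  have e1 : ∀ s, eLpNorm (deltaBer p s f) 1 (mu S p) ^ 2 = ENNReal.ofReal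
      ((∫ z, |f z - avg (coordKernel p (.inl s)) f z| ∂(mu S p)) ^ 2) := fun s => by
    rw [deltaBer_eq hf, eLpNorm_one_sq ((hd _).integrable one_le_two)]
  have e2 : ∀ i, eLpNorm (deltaGauss i f) 1 (mu S p) ^ 2 = ENNReal.ofReal
      ((∫ z, |f z - avg (coordKernel p (.inr i)) f z| ∂(mu S p)) ^ 2) := fun i => by
    rw [deltaGauss_eq (p := p) hf, eLpNorm_one_sq ((hd _).integrable one_le_two)]
  have e3 : ∀ s, ENNReal.ofReal (cLS p) * energy p (deltaBer p s f) = ENNReal.ofReal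
      (coordConst p (.inl s : S ⊕ ℕ) * ∫ z, G (.inl s) z ^ 2 ∂(mu S p)) := fun s => by
    have hs : MemLp (deltaBer p s f) 2 (mu S p) := (hG (.inl s)).memLp_grad
    rw [energy_eq_ofReal_integral hs, coordConst,
      ENNReal.ofReal_mul (cLS_pos hp0 hp1).le]
    rfl
  have e4 : ∀ i, 2 * energy p (df i) = ENNReal.ofReal
      (coordConst p (.inr i : S ⊕ ℕ) * ∫ z, G (.inr i) z ^ 2 ∂(mu S p)) := fun i => by
    rw [energy_eq_ofReal_integral (H i).1, coordConst, ENNReal.ofReal_mul zero_le_two,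
      ENNReal.ofReal_ofNat]
    rfl
  rw [← ENNReal.tsum_mul_left, ← ENNReal.tsum_mul_left]
  simp_rw [e1, e2, e3, e4]
  exact key

end BernoulliGauss

end

/-- The inequality holds in `[-∞, ∞]`: the sums may be infinite, `log 0 = -∞`, and the left side is
`0` if the variance is `0`. -/
theorem mainTheorem6 {S : Type*} [Countable S] (p : unitInterval) (hp0 : 0 < p) (hp1 : p < 1)
    (f : BernoulliGauss.Space S → ℝ) (hf : BernoulliGauss.MemH12 p f)
    (df : ℕ → BernoulliGauss.Space S → ℝ)
    (hdf : ∀ i, BernoulliGauss.IsPartialDeriv p i f (df i)) :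
    ((evariance f (BernoulliGauss.mu S p) : ℝ≥0∞) : EReal) *
        ENNReal.log (evariance f (BernoulliGauss.mu S p) /
          ((∑' s : S, eLpNorm (BernoulliGauss.deltaBer p s f) 1 (BernoulliGauss.mu S p) ^ 2) +
            ∑' i : ℕ, eLpNorm (BernoulliGauss.deltaGauss i f) 1 (BernoulliGauss.mu S p) ^ 2))
      ≤ ((ENNReal.ofReal (BernoulliGauss.cLS p) *
            (∑' s : S, BernoulliGauss.energy p (BernoulliGauss.deltaBer p s f)) +
          2 * ∑' i : ℕ, BernoulliGauss.energy p (df i) : ℝ≥0∞) : EReal) := by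
  -- Every term depends only on almost everywhere classes, so `f` and its derivatives are replaced
  -- by strongly measurable representatives.
  have hm := hf.1.1.ae_eq_mk
  have hd := fun i => (hdf i).1.1.ae_eq_mk
  have key := BernoulliGauss.evariance_mul_log_le_of_stronglyMeasurable hp0 hp1
    hf.1.1.stronglyMeasurable_mk ((memLp_congr_ae hm).1 hf.1)
    (fun i => (hdf i).1.1.stronglyMeasurable_mk) fun i => (hdf i).congr hm (hd i)
  have e1 := fun s => BernoulliGauss.deltaBer_congr hm s
  have e2 := fun i => BernoulliGauss.deltaGauss_congr hm i
  simp_rw [← evariance_congr hm, ← fun s => eLpNorm_congr_ae (p := 1) (e1 s),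
    ← fun i => eLpNorm_congr_ae (p := 1) (e2 i), ← fun s => BernoulliGauss.energy_congr (e1 s),
    ← fun i => BernoulliGauss.energy_congr (hd i)] at key
  exact key
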